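/- Let $T_L,D_L,a_L,T_R,D_R,a_R\in\mathbb{R}$ be arbitrary and consider the planar piecewise linear system $$\dot x=T_Lx-y,\ \ \dot y=D_Lx-a_L\quad (x<0),\qquad\qquad \dot x=T_Rx-y,\ \ \dot y=D_Rx-a_R\quad (x>0),$$ with switching line $\Sigma=\{x=0\}$. A closed crossing orbit is the orbit of a periodic solution that meets $\Sigma$, and meets it only transversally (that is, never at the origin); a limit cycle is a closed crossing orbit that has a neighbourhood containing no other closed crossing orbit. The forward half-map $y_L$ sends $y_0\ge 0$ to the ordinate $y_L(y_0)\le 0$ of the first return to $\Sigma$ of the forward orbit of $(0,y_0)$ through $\{x<0\}$; the backward half-map $y_R$ sends $y_0\ge 0$ to the ordinate $y_R(y_0)\le 0$ of the first return to $\Sigma$ of the backward orbit of $(0,y_0)$ through $\{x>0\}$ (each is extended by the value $0$ at $y_0=0$ when arbitrarily small positive ordinates are mapped to arbitrarily small negative ones). Let $I$ be the intersection of the domains of the two half-maps and let $\delta(y_0)=y_R(y_0)-y_L(y_0)$, $y_0\in I$, be the displacement function. A limit cycle is called hyperbolic if it passes through a point $(0,y_0^*)$ with $y_0^*>0$, $y_0^*\in\operatorname{int}(I)$,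 $\delta(y_0^*)=0$ and $\delta'(y_0^*)\neq 0$, and degenerate otherwise. Then the system has no degenerate limit cycle. -/

import Mathlib

/-- The six real parameters of the planar piecewise linear system in Liénard form
`x' = TL x - y, y' = DL x - aL` for `x < 0`, and
`x' = TR x - y, y' = DR x - aR` for `x > 0`, with switching line `x = 0`. -/
structure LienardPWL where
  TL : ℝ
  DL : ℝ
  aL : ℝ
  TR : ℝ
  DR : ℝ
  aR : ℝ

namespace LienardPWL

/-- `t ↦ (x t, y t)` is an orbit of the linear system `x' = T x - y, y' = D x - a`. -/
def IsLinearOrbit (T D a : ℝ) (x y : ℝ → ℝ) : Prop :=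
  ∀ t, HasDerivAt x (T * x t - y t) t ∧ HasDerivAt y (D * x t - a) t

/-- Following the flow forward from `(0, y₀)` through `x < 0`, the first return to the switching
line is `(0, y₁)`. -/
def LeftReturn (S : LienardPWL) (y₀ y₁ : ℝ) : Prop :=
  ∃ x y : ℝ → ℝ, IsLinearOrbit S.TL S.DL S.aL x y ∧ x 0 = 0 ∧ y 0 = y₀ ∧
    ∃ τ : ℝ, 0 < τ ∧ x τ = 0 ∧ y τ = y₁ ∧ ∀ t ∈ Set.Ioo 0 τ, x t < 0

/-- Following the flow backward from `(0, y₀)` through `x > 0`, the first return to the switching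
line is `(0, y₁)`. -/
def RightReturn (S : LienardPWL) (y₀ y₁ : ℝ) : Prop :=
  ∃ x y : ℝ → ℝ, IsLinearOrbit S.TR S.DR S.aR x y ∧ x 0 = 0 ∧ y 0 = y₀ ∧
    ∃ τ : ℝ, τ < 0 ∧ x τ = 0 ∧ y τ = y₁ ∧ ∀ t ∈ Set.Ioo τ 0, 0 < x t

/-- The domain of the half-map given by a return relation `R`: all `y₀ ≥ 0` from which the orbit
returns, together with `y₀ = 0` when the half-map extends to it by the value `0`. -/
def halfMapDomain (R : ℝ → ℝ → Prop) : Set ℝ :=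
  {y₀ | 0 ≤ y₀ ∧ ((∃ y₁, R y₀ y₁) ∨
    (y₀ = 0 ∧ ∀ ε > 0, ∃ u ∈ Set.Ioo 0 ε, ∃ v ∈ Set.Ioo (-ε) 0, R u v))}

open Classical in
/-- The half-map given by a return relation `R` (meaningful on `halfMapDomain R`); it takes the
value `0` at `y₀ = 0` when it is only defined there by extension. -/
noncomputable def halfMap (R : ℝ → ℝ → Prop) (y₀ : ℝ) : ℝ :=
  if h : ∃ y₁, R y₀ y₁ then h.choose else 0

/-- The forward Poincaré half-map `y_L`. -/
noncomputable def yL (S : LienardPWL) : ℝ → ℝ := halfMap S.LeftReturn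

/-- The backward Poincaré half-map `y_R`. -/
noncomputable def yR (S : LienardPWL) : ℝ → ℝ := halfMap S.RightReturn

/-- The common domain `I = I_L ∩ I_R` of the two half-maps. -/
def displacementDomain (S : LienardPWL) : Set ℝ :=
  halfMapDomain S.LeftReturn ∩ halfMapDomain S.RightReturn

/-- The displacement function `δ = y_R - y_L` (meaningful on `I`). -/
noncomputable def displacement (S : LienardPWL) (y₀ : ℝ) : ℝ := S.yR y₀ - S.yL y₀

/-- `t ↦ (x t, y t)` is a solution of the piecewise linear system that meets the switching line
only transversally, that is, never at the origin. Both vector fields have first component `-y` on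
the switching line, so `x` is differentiable at every time. -/
structure IsCrossingSolution (S : LienardPWL) (x y : ℝ → ℝ) : Prop where
  continuous_y : Continuous y
  left : ∀ t, x t < 0 →
    HasDerivAt x (S.TL * x t - y t) t ∧ HasDerivAt y (S.DL * x t - S.aL) t
  right : ∀ t, 0 < x t →
    HasDerivAt x (S.TR * x t - y t) t ∧ HasDerivAt y (S.DR * x t - S.aR) t
  crossing : ∀ t, x t = 0 → y t ≠ 0 ∧ HasDerivAt x (-(y t)) t

/-- `Γ` is the orbit of a periodic crossing solution which does meet the switching line. Such a
solution is not constant, since it crosses the line with nonzero speed. -/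
def IsCrossingClosedOrbit (S : LienardPWL) (Γ : Set (ℝ × ℝ)) : Prop :=
  ∃ x y : ℝ → ℝ, S.IsCrossingSolution x y ∧
    (∃ T : ℝ, 0 < T ∧ Function.Periodic x T ∧ Function.Periodic y T) ∧
    (∃ t, x t = 0) ∧ Γ = Set.range fun t => (x t, y t)

/-- A limit cycle: a closed crossing orbit isolated from the other ones. -/
def IsLimitCycle (S : LienardPWL) (Γ : Set (ℝ × ℝ)) : Prop :=
  S.IsCrossingClosedOrbit Γ ∧ ∃ U : Set (ℝ × ℝ), IsOpen U ∧ Γ ⊆ U ∧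
    ∀ Γ' : Set (ℝ × ℝ), S.IsCrossingClosedOrbit Γ' → Γ' ⊆ U → Γ' = Γ

/-- `Γ` passes through a point `(0, y₀)`, `y₀ > 0`, with `y₀` a simple zero of the displacement
function in the interior of its domain. -/
def IsHyperbolic (S : LienardPWL) (Γ : Set (ℝ × ℝ)) : Prop :=
  ∃ y₀ : ℝ, 0 < y₀ ∧ ((0 : ℝ), y₀) ∈ Γ ∧ y₀ ∈ interior S.displacementDomain ∧
    S.displacement y₀ = 0 ∧ ∃ d : ℝ, d ≠ 0 ∧ HasDerivAt S.displacement d y₀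

/-- A degenerate limit cycle is a limit cycle which is not hyperbolic. -/
def IsDegenerateLimitCycle (S : LienardPWL) (Γ : Set (ℝ × ℝ)) : Prop :=
  S.IsLimitCycle Γ ∧ ¬ S.IsHyperbolic Γ

end LienardPWL

open Set Filter Topology

/-! Let a closed crossing orbit meet the switching line at `y₀ > 0 > y₁`, with arc times `τ` on the
left and `σ` on the right. Implicit differentiation and the Wronskian give the slopes `(y₀ / y₁)
e^{TL τ}` and `(y₀ / y₁) e^{-TR σ}` for the two half-maps (`Ret.exists_local`). The orbit is
therefore hyperbolic unless `TL τ + TR σ = 0`, that is, unless the integral of the divergence along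
it vanishes.

In that exceptional case the half-maps coincide near `y₀` (`eventually_halfMaps_eq`), so the nearby
orbits are closed as well and the orbit is not isolated. The coincidence is a rigidity statement
(`Ret.parameters_eq`): the endpoints and a nonzero value of `T τ` determine a linear system up to
time scale. If the traces are zero, both half-maps are `y ↦ -y`.

For rigidity, put `h = T τ / 2` and `z = (D - T² / 4) τ²`. Eliminating `a τ` from the closing
equations says that `z` is a second intersection of the curve `(cosq, sinq)` with a line through its
point of parameter `-h²`, whose slope `m` is fixed by `h, y₀, y₁`. First-return times satisfy `z <
4π²` (`Ret.sq_lt`), and in that range the second intersection is unique (`SecantAt.param_eq`): by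
Rolle, two of them would give two critical points of `sinq - m cosq`, which is excluded by
monotonicity of `pq / sinq` on each side of its pole `π²` together with a comparison of values at
`4π²`. Then `z` gives `D τ²`, and a closing equation gives `a τ`. -/

/-! ### Trigonometric and hyperbolic functions as one analytic family. -/

/-- The entire function `cos √z`. -/
noncomputable def cosq (z : ℝ) : ℝ :=
  if 0 ≤ z then Real.cos (√z) else Real.cosh (√(-z))

/-- The entire function `sin √z / √z`. -/
noncomputable def sinq (z : ℝ) : ℝ :=
  if z = 0 then 1 else if 0 < z then Real.sin (√z) / √z else Real.sinh (√(-z)) / √(-z)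

/-- The solution of `C'' = -z C`, `C 0 = 1`, `C' 0 = 0`. -/
noncomputable def cn (z t : ℝ) : ℝ := cosq (z * t ^ 2)

/-- The solution of `S'' = -z S`, `S 0 = 0`, `S' 0 = 1`. -/
noncomputable def sn (z t : ℝ) : ℝ := t * sinq (z * t ^ 2)

theorem cosq_sq (w : ℝ) : cosq (w ^ 2) = Real.cos w := by
  simp [cosq, sq_nonneg, Real.sqrt_sq_eq_abs]

theorem cosq_neg_sq (w : ℝ) : cosq (-w ^ 2) = Real.cosh w := by
  rcases eq_or_ne w 0 with rfl | hw
  · simp [cosq]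
  · have : ¬ (0 ≤ -w ^ 2) := by have := sq_pos_of_ne_zero hw; linarith
    simp [cosq, this, Real.sqrt_sq_eq_abs]

theorem mul_sinq_sq (w : ℝ) : w * sinq (w ^ 2) = Real.sin w := by
  rcases lt_trichotomy w 0 with hw | rfl | hw
  · have h : 0 < w ^ 2 := sq_pos_of_neg hw
    rw [sinq, if_neg h.ne', if_pos h, Real.sqrt_sq_eq_abs, abs_of_neg hw, Real.sin_neg]
    field_simp [hw.ne]
  · simp
  · have h : 0 < w ^ 2 := by positivity
    rw [sinq, if_neg h.ne', if_pos h, Real.sqrt_sq_eq_abs, abs_of_pos hw]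
    field_simp

theorem mul_sinq_neg_sq (w : ℝ) : w * sinq (-w ^ 2) = Real.sinh w := by
  rcases lt_trichotomy w 0 with hw | rfl | hw
  · have h : 0 < w ^ 2 := sq_pos_of_neg hw
    rw [sinq, if_neg (by linarith), if_neg (by linarith), neg_neg, Real.sqrt_sq_eq_abs,
      abs_of_neg hw, Real.sinh_neg]
    field_simp [hw.ne]
  · simp
  · have h : 0 < w ^ 2 := by positivity
    rw [sinq, if_neg (by linarith), if_neg (by linarith), neg_neg, Real.sqrt_sq_eq_abs,
      abs_of_pos hw]
    field_simp

theorem sinq_zero : sinq 0 = 1 := by simp [sinq]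

theorem cosq_zero : cosq 0 = 1 := by simp [cosq]

/-- The trigonometric, polynomial and hyperbolic cases are separated only here; identities verified
in each of them make later arguments uniform in the sign of `z`. -/
theorem cn_sn_cases (z : ℝ) :
    (∃ w : ℝ, 0 < w ∧ z = w ^ 2 ∧ cn z = (fun t => Real.cos (w * t)) ∧
      sn z = fun t => Real.sin (w * t) / w) ∨
    (z = 0 ∧ cn z = (fun _ => 1) ∧ sn z = fun t => t) ∨
    (∃ w : ℝ, 0 < w ∧ z = -w ^ 2 ∧ cn z = (fun t => Real.cosh (w * t)) ∧
      sn z = fun t => Real.sinh (w * t) / w) := by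
  rcases lt_trichotomy z 0 with h | rfl | h
  · right; right
    have hw : 0 < √(-z) := Real.sqrt_pos.2 (by linarith)
    have hz : z = -(√(-z)) ^ 2 := by rw [Real.sq_sqrt (by linarith)]; ring
    refine ⟨√(-z), hw, hz, ?_, ?_⟩ <;> funext t
    · rw [← cosq_neg_sq, cn]; congr 1; nlinarith
    · rw [← mul_sinq_neg_sq, sn, eq_div_iff hw.ne']
      have : z * t ^ 2 = -(√(-z) * t) ^ 2 := by nlinarith
      rw [this]; ring
  · right; left
    refine ⟨rfl, ?_, ?_⟩ <;> funext t <;> simp [cn, sn, cosq_zero, sinq_zero]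
  · left
    have hw : 0 < √z := Real.sqrt_pos.2 h
    have hz : z = (√z) ^ 2 := by rw [Real.sq_sqrt h.le]
    refine ⟨√z, hw, hz, ?_, ?_⟩ <;> funext t
    · rw [← cosq_sq, cn]; congr 1; nlinarith
    · rw [← mul_sinq_sq, sn, eq_div_iff hw.ne']
      have : z * t ^ 2 = (√z * t) ^ 2 := by nlinarith
      rw [this]; ring

theorem hasDerivAt_sn (z t : ℝ) : HasDerivAt (sn z) (cn z t) t := by
  rcases cn_sn_cases z with ⟨w, hw, -, hc, hs⟩ | ⟨-, hc, hs⟩ | ⟨w, hw, -, hc, hs⟩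
  · rw [hc, hs]
    have := (((hasDerivAt_id t).const_mul w).sin).div_const w
    refine this.congr_deriv ?_
    simp; field_simp
  · rw [hc, hs]; exact hasDerivAt_id t
  · rw [hc, hs]
    have := (((hasDerivAt_id t).const_mul w).sinh).div_const w
    refine this.congr_deriv ?_
    simp; field_simp

theorem hasDerivAt_cn (z t : ℝ) : HasDerivAt (cn z) (-z * sn z t) t := by
  rcases cn_sn_cases z with ⟨w, hw, hz, hc, hs⟩ | ⟨hz, hc, hs⟩ | ⟨w, hw, hz, hc, hs⟩
  · rw [hc, hs, hz]
    have := (((hasDerivAt_id t).const_mul w).cos)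
    refine this.congr_deriv ?_
    simp; field_simp
  · rw [hc, hs, hz]; simpa using hasDerivAt_const t (1 : ℝ)
  · rw [hc, hs, hz]
    have := (((hasDerivAt_id t).const_mul w).cosh)
    refine this.congr_deriv ?_
    simp; field_simp

theorem cn_sq_add (z t : ℝ) : cn z t ^ 2 + z * sn z t ^ 2 = 1 := by
  rcases cn_sn_cases z with ⟨w, hw, hz, hc, hs⟩ | ⟨hz, hc, hs⟩ | ⟨w, hw, hz, hc, hs⟩
  · rw [hc, hs, hz]
    have := Real.sin_sq_add_cos_sq (w * t)
    field_simp; linarith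
  · rw [hc, hs, hz]; simp
  · rw [hc, hs, hz]
    have := Real.cosh_sq (w * t)
    field_simp; linarith

theorem cn_zero (z : ℝ) : cn z 0 = 1 := by simp [cn, cosq_zero]
theorem sn_zero (z : ℝ) : sn z 0 = 0 := by simp [sn]
theorem cn_one (z : ℝ) : cn z 1 = cosq z := by simp [cn]
theorem sn_one (z : ℝ) : sn z 1 = sinq z := by simp [sn]

theorem continuous_sn (z : ℝ) : Continuous (sn z) :=
  continuous_iff_continuousAt.2 fun t => (hasDerivAt_sn z t).continuousAt

theorem continuous_cn (z : ℝ) : Continuous (cn z) :=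
  continuous_iff_continuousAt.2 fun t => (hasDerivAt_cn z t).continuousAt

theorem cosq_sq_add (z : ℝ) : cosq z ^ 2 + z * sinq z ^ 2 = 1 := by
  simpa [cn_one, sn_one] using cn_sq_add z 1

theorem continuous_cosq : Continuous cosq := by
  unfold cosq
  refine Continuous.if_le (by fun_prop) (by fun_prop) continuous_const continuous_id ?_
  rintro x rfl
  simp

theorem sinq_eq_integral (z : ℝ) : sinq z = ∫ t in (0 : ℝ)..1, cosq (z * t ^ 2) := by
  have := intervalIntegral.integral_eq_sub_of_hasDerivAt (a := 0) (b := 1)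
    (fun t _ => hasDerivAt_sn z t) ((continuous_cn z).intervalIntegrable _ _)
  rw [sn_zero, sn_one, sub_zero] at this
  exact this.symm

theorem continuous_sinq : Continuous sinq := by
  have h : sinq = fun z => ∫ t in (0 : ℝ)..1, cosq (z * t ^ 2) := funext sinq_eq_integral
  rw [h]
  refine intervalIntegral.continuous_parametric_intervalIntegral_of_continuous' ?_ 0 1
  exact continuous_cosq.comp (by fun_prop)

/-- The entire function `(sin √z / √z - cos √z) / z`. -/
noncomputable def pq (z : ℝ) : ℝ := ∫ t in (0 : ℝ)..1, t * (t * sinq (z * t ^ 2))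

theorem continuous_pq : Continuous pq := by
  refine intervalIntegral.continuous_parametric_intervalIntegral_of_continuous' ?_ 0 1
  have := continuous_sinq
  exact (by fun_prop : Continuous fun x : ℝ × ℝ => x.2 * (x.2 * sinq (x.1 * x.2 ^ 2)))

theorem hasDerivAt_sn_sub (z t : ℝ) :
    HasDerivAt (fun t => sn z t - t * cn z t) (z * (t * sn z t)) t := by
  refine ((hasDerivAt_sn z t).sub ((hasDerivAt_id t).mul (hasDerivAt_cn z t))).congr_deriv ?_
  simp; ring

theorem mul_pq (z : ℝ) : z * pq z = sinq z - cosq z := by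
  have := intervalIntegral.integral_eq_sub_of_hasDerivAt (a := 0) (b := 1)
    (fun t _ => hasDerivAt_sn_sub z t)
    ((continuous_const.mul (continuous_id.mul (continuous_sn z))).intervalIntegrable _ _)
  simp only [sn_zero, sn_one, cn_one] at this
  rw [pq, ← intervalIntegral.integral_const_mul]
  simpa [sn] using this

theorem hasDerivAt_sqrt_div {z : ℝ} (hz : z ≠ 0) :
    HasDerivAt (fun u => √(u / z)) (1 / (2 * z)) z := by
  have := ((hasDerivAt_id z).div_const z).sqrt (by simp [hz])
  refine this.congr_deriv ?_
  simp [hz]; field_simp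

theorem eventually_mul_sqrt_div {z : ℝ} (hz : z ≠ 0) :
    ∀ᶠ u in 𝓝 z, z * √(u / z) ^ 2 = u ∧ 0 < √(u / z) := by
  have : Tendsto (fun u => u / z) (𝓝 z) (𝓝 1) := by
    have h : ContinuousAt (fun u => u / z) z := by fun_prop
    simpa [ContinuousAt, hz] using h
  filter_upwards [this.eventually (lt_mem_nhds (zero_lt_one))] with u hu
  exact ⟨by rw [Real.sq_sqrt hu.le]; field_simp, Real.sqrt_pos.2 hu⟩

/-- For `u` near `z ≠ 0`, `cosq u` is `cn z` at time `√(u / z)`, so the time derivative yields the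
derivative in the parameter. The point `0` follows from continuity of the candidate derivative. -/
theorem hasDerivAt_cosq (z : ℝ) : HasDerivAt cosq (-(sinq z) / 2) z := by
  refine hasDerivAt_of_hasDerivAt_of_ne' (g := fun z => -(sinq z) / 2) (x := 0) (fun z hz => ?_)
    continuous_cosq.continuousAt (continuous_sinq.neg.div_const 2).continuousAt z
  have h1 := hasDerivAt_cn z (√(z / z))
  have h := h1.comp z (hasDerivAt_sqrt_div hz)
  have h2 : √(z / z) = 1 := by simp [hz]
  rw [h2, sn_one] at h
  refine (h.congr_of_eventuallyEq ?_).congr_deriv (by field_simp)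
  filter_upwards [eventually_mul_sqrt_div hz] with u hu
  simp [cn, hu.1]

theorem hasDerivAt_sinq (z : ℝ) : HasDerivAt sinq (-(pq z) / 2) z := by
  refine hasDerivAt_of_hasDerivAt_of_ne' (g := fun z => -(pq z) / 2) (x := 0) (fun z hz => ?_)
    continuous_sinq.continuousAt (continuous_pq.neg.div_const 2).continuousAt z
  have h1 := hasDerivAt_sn z (√(z / z))
  have h := (h1.comp z (hasDerivAt_sqrt_div hz)).div (hasDerivAt_sqrt_div hz) (by simp [hz])
  have h2 : √(z / z) = 1 := by simp [hz]
  simp only [Function.comp, h2, sn_one, cn_one] at h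
  refine (h.congr_of_eventuallyEq ?_).congr_deriv ?_
  · filter_upwards [eventually_mul_sqrt_div hz] with u hu
    simp [sn, hu.1, hu.2.ne']
  · have := mul_pq z
    field_simp
    linarith

theorem hasDerivAt_pq {z : ℝ} (hz : z ≠ 0) :
    HasDerivAt pq ((sinq z - 3 * pq z) / (2 * z)) z := by
  have h := ((hasDerivAt_sinq z).sub (hasDerivAt_cosq z)).div (hasDerivAt_id z) hz
  refine (h.congr_of_eventuallyEq ?_).congr_deriv ?_
  · filter_upwards [isOpen_ne.mem_nhds hz] with u hu
    have := mul_pq u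
    simp only [Pi.div_apply, Pi.sub_apply, id]
    rw [eq_div_iff hu]; linarith
  · have := mul_pq z
    simp only [id, Pi.sub_apply]
    rw [← this]
    field_simp
    ring

theorem sinq_pos {z : ℝ} (hz : z < Real.pi ^ 2) : 0 < sinq z := by
  have hpi := Real.pi_pos
  rcases lt_trichotomy z 0 with h | rfl | h
  · rw [sinq, if_neg h.ne, if_neg h.le.not_gt]
    have : 0 < √(-z) := Real.sqrt_pos.2 (by linarith)
    exact div_pos (Real.sinh_pos_iff.2 this) this
  · simp [sinq_zero]
  · rw [sinq, if_neg h.ne', if_pos h]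
    have h1 : 0 < √z := Real.sqrt_pos.2 h
    have h2 : √z < Real.pi := (Real.sqrt_lt' hpi).2 hz
    exact div_pos (Real.sin_pos_of_pos_of_lt_pi h1 h2) h1

theorem sinq_neg {z : ℝ} (hz : Real.pi ^ 2 < z) (hz' : z < 4 * Real.pi ^ 2) : sinq z < 0 := by
  have hpi := Real.pi_pos
  have h : 0 < z := lt_trans (by positivity) hz
  rw [sinq, if_neg h.ne', if_pos h]
  have h1 : Real.pi < √z := (Real.lt_sqrt hpi.le).2 hz
  have h2 : √z < 2 * Real.pi := (Real.sqrt_lt' (by positivity)).2 (by linarith)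
  have h3 : 0 < Real.sin (√z - Real.pi) :=
    Real.sin_pos_of_pos_of_lt_pi (by linarith) (by linarith)
  rw [Real.sin_sub_pi] at h3
  exact div_neg_of_neg_of_pos (by linarith) (by linarith)

theorem sinq_pi_sq : sinq (Real.pi ^ 2) = 0 := by
  have := mul_sinq_sq Real.pi
  simpa [Real.pi_ne_zero] using this

theorem cosq_pi_sq : cosq (Real.pi ^ 2) = -1 := by simp [cosq_sq]

theorem sinq_four_pi_sq : sinq (4 * Real.pi ^ 2) = 0 := by
  have := mul_sinq_sq (2 * Real.pi)
  rw [show (2 * Real.pi) ^ 2 = 4 * Real.pi ^ 2 by ring] at this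
  simpa [Real.pi_ne_zero] using this

theorem cosq_four_pi_sq : cosq (4 * Real.pi ^ 2) = 1 := by
  have := cosq_sq (2 * Real.pi)
  rw [show (2 * Real.pi) ^ 2 = 4 * Real.pi ^ 2 by ring] at this
  simpa using this

theorem pq_pi_sq_ne_zero : pq (Real.pi ^ 2) ≠ 0 := by
  intro h
  have := mul_pq (Real.pi ^ 2)
  rw [h, sinq_pi_sq, cosq_pi_sq] at this
  norm_num at this

theorem sn_pos {z t : ℝ} (ht : 0 < t) (h : z * t ^ 2 < Real.pi ^ 2) : 0 < sn z t :=
  mul_pos ht (sinq_pos h)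

/-! ### Monotonicity of `pq / sinq`. -/

/-- Positivity of a second derivative, for a function with vanishing initial data. -/
theorem pos_of_second_deriv_pos {f f' f'' : ℝ → ℝ} (h1 : ∀ t, HasDerivAt f (f' t) t)
    (h2 : ∀ t, HasDerivAt f' (f'' t) t) (h0 : f 0 = 0) (h0' : f' 0 = 0)
    (h : ∀ t ∈ Ioo (0 : ℝ) 1, 0 < f'' t) : 0 < f 1 := by
  have hf' : ∀ t ∈ Ioc (0 : ℝ) 1, 0 < f' t := by
    intro t ht
    have : StrictMonoOn f' (Icc 0 1) := strictMonoOn_of_deriv_pos (convex_Icc _ _)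
      (fun t _ => (h2 t).continuousAt.continuousWithinAt)
      (fun t ht => by rw [interior_Icc] at ht; rw [(h2 t).deriv]; exact h t ht)
    have := this (left_mem_Icc.2 zero_le_one) ⟨ht.1.le, ht.2⟩ ht.1
    rwa [h0'] at this
  have : StrictMonoOn f (Icc 0 1) := strictMonoOn_of_deriv_pos (convex_Icc _ _)
      (fun t _ => (h1 t).continuousAt.continuousWithinAt)
      (fun t ht => by
        rw [interior_Icc] at ht; rw [(h1 t).deriv]; exact hf' t ⟨ht.1, ht.2.le⟩)
  have := this (left_mem_Icc.2 zero_le_one) (right_mem_Icc.2 zero_le_one) zero_lt_one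
  rwa [h0] at this

theorem pos_of_deriv_pos {f f' : ℝ → ℝ} {T : ℝ} (h1 : ∀ t, HasDerivAt f (f' t) t) (h0 : f 0 = 0)
    (hT : 0 < T) (h : ∀ t ∈ Ioo (0 : ℝ) T, 0 < f' t) : 0 < f T := by
  have : StrictMonoOn f (Icc 0 T) := strictMonoOn_of_deriv_pos (convex_Icc _ _)
      (fun t _ => (h1 t).continuousAt.continuousWithinAt)
      (fun t ht => by rw [interior_Icc] at ht; rw [(h1 t).deriv]; exact h t ht)
  have := this (left_mem_Icc.2 hT.le) (right_mem_Icc.2 hT.le) hT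
  rwa [h0] at this

/-- This is the numerator of `(pq / sinq)'`. It is the value at `t = 1` of `t² + t S C - 2 S²`, with
`S = sn z` and `C = cn z`. That function vanishes to second order at `0`, and its second derivative
`4 S · z (S - t C)` is positive because `z (S - t C)` starts at `0` with derivative `z² t S`. -/
theorem one_add_sinq_mul_cosq_pos_of_lt {z : ℝ} (hz0 : z ≠ 0) (hz : z < Real.pi ^ 2) :
    0 < 1 + sinq z * cosq z - 2 * sinq z ^ 2 := by
  have hs : ∀ t ∈ Ioo (0 : ℝ) 1, 0 < sn z t := by
    intro t ht
    refine sn_pos ht.1 ?_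
    have : t ^ 2 < 1 := by nlinarith [ht.1, ht.2]
    rcases le_or_gt z 0 with h | h
    · have := mul_nonpos_of_nonpos_of_nonneg h (sq_nonneg t)
      have : 0 < Real.pi ^ 2 := by positivity
      linarith
    · nlinarith
  have hP : ∀ t ∈ Ioo (0 : ℝ) 1, 0 < z * (sn z t - t * cn z t) := by
    intro t ht
    have hd : ∀ u, HasDerivAt (fun u => z * (sn z u - u * cn z u)) (z * (z * (u * sn z u))) u :=
      fun u => (hasDerivAt_sn_sub z u).const_mul z
    refine pos_of_deriv_pos (f := fun u => z * (sn z u - u * cn z u)) hd (by simp [sn_zero]) ht.1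
      fun u hu => ?_
    have h1 := hs u ⟨hu.1, hu.2.trans ht.2⟩
    have h2 : 0 < z * z := mul_self_pos.2 hz0
    rw [← mul_assoc]
    exact mul_pos h2 (mul_pos hu.1 h1)
  have h1 : ∀ t, HasDerivAt (fun t => t ^ 2 + t * (sn z t * cn z t) - 2 * sn z t ^ 2)
      (2 * t - 3 * (sn z t * cn z t) + t * (cn z t ^ 2 - z * sn z t ^ 2)) t := by
    intro t
    have hS := hasDerivAt_sn z t
    have hC := hasDerivAt_cn z t
    refine (((hasDerivAt_id t).pow 2).add ((hasDerivAt_id t).mul (hS.mul hC)) |>.sub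
      ((hS.pow 2).const_mul 2)).congr_deriv ?_
    simp; ring
  have h2 : ∀ t, HasDerivAt
      (fun t => 2 * t - 3 * (sn z t * cn z t) + t * (cn z t ^ 2 - z * sn z t ^ 2))
      (4 * sn z t * (z * (sn z t - t * cn z t))) t := by
    intro t
    have hS := hasDerivAt_sn z t
    have hC := hasDerivAt_cn z t
    refine ((((hasDerivAt_id t).const_mul 2).sub ((hS.mul hC).const_mul 3)).add
      ((hasDerivAt_id t).mul ((hC.pow 2).sub ((hS.pow 2).const_mul z)))).congr_deriv ?_
    have := cn_sq_add z t
    simp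
    linear_combination (-2) * this
  have := pos_of_second_deriv_pos h1 h2 (by simp [sn_zero]) (by simp [sn_zero])
    fun t ht => mul_pos (mul_pos (by norm_num) (hs t ht)) (hP t ht)
  simpa [sn_one, cn_one] using this

/-- Since `z > 9`, the identity `cosq² + z sinq² = 1` makes `sinq` small enough for a crude
quadratic estimate. -/
theorem one_add_sinq_mul_cosq_pos_of_gt {z : ℝ} (hz : Real.pi ^ 2 < z) :
    0 < 1 + sinq z * cosq z - 2 * sinq z ^ 2 := by
  have h1 := cosq_sq_add z
  have h2 := Real.pi_gt_three
  have h4 : 9 < z := by nlinarith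
  have h3 : 9 * sinq z ^ 2 + cosq z ^ 2 ≤ 1 := by
    nlinarith [sq_nonneg (sinq z)]
  nlinarith [sq_nonneg (sinq z + cosq z)]

theorem hasDerivAt_pq_div_sinq {z : ℝ} (hz : z ≠ 0) (hs : sinq z ≠ 0) :
    HasDerivAt (fun z => pq z / sinq z)
      ((1 + sinq z * cosq z - 2 * sinq z ^ 2) / (2 * z ^ 2 * sinq z ^ 2)) z := by
  refine ((hasDerivAt_pq hz).div (hasDerivAt_sinq z) hs).congr_deriv ?_
  have h1 := mul_pq z
  have h2 := cosq_sq_add z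
  have h3 : cosq z = sinq z - z * pq z := by linarith
  rw [h3] at h2 ⊢
  field_simp
  linear_combination h2

theorem continuousOn_pq_div_sinq {A : Set ℝ} (h : ∀ z ∈ A, sinq z ≠ 0) :
    ContinuousOn (fun z => pq z / sinq z) A :=
  continuous_pq.continuousOn.div continuous_sinq.continuousOn h

theorem strictMonoOn_pq_div_sinq_Iio :
    StrictMonoOn (fun z => pq z / sinq z) (Iio (Real.pi ^ 2)) := by
  have hpi : 0 < Real.pi ^ 2 := by positivity
  have key : ∀ z, z ≠ 0 → z < Real.pi ^ 2 → 0 < deriv (fun z => pq z / sinq z) z := by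
    intro z hz hz'
    have hs := sinq_pos hz'
    rw [(hasDerivAt_pq_div_sinq hz hs.ne').deriv]
    have := one_add_sinq_mul_cosq_pos_of_lt hz hz'
    positivity
  -- The derivative formula divides by `z²`, so monotonicity is proved on both sides of `0` and
  -- glued.
  have h1 : StrictMonoOn (fun z => pq z / sinq z) (Iic 0) := by
    refine strictMonoOn_of_deriv_pos (convex_Iic _)
      (continuousOn_pq_div_sinq fun z hz => (sinq_pos (lt_of_le_of_lt hz hpi)).ne') fun z hz => ?_
    rw [interior_Iic] at hz
    exact key z hz.ne (lt_trans hz hpi)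
  have h2 : StrictMonoOn (fun z => pq z / sinq z) (Ico 0 (Real.pi ^ 2)) := by
    refine strictMonoOn_of_deriv_pos (convex_Ico _ _)
      (continuousOn_pq_div_sinq fun z hz => (sinq_pos hz.2).ne') fun z hz => ?_
    rw [interior_Ico] at hz
    exact key z hz.1.ne' hz.2
  have := h1.union h2 isGreatest_Iic (isLeast_Ico hpi)
  rwa [Iic_union_Ico_eq_Iio hpi] at this

theorem strictMonoOn_pq_div_sinq_Ioo :
    StrictMonoOn (fun z => pq z / sinq z) (Ioo (Real.pi ^ 2) (4 * Real.pi ^ 2)) := by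
  have hpi : 0 < Real.pi ^ 2 := by positivity
  refine strictMonoOn_of_deriv_pos (convex_Ioo _ _)
    (continuousOn_pq_div_sinq fun z hz => (sinq_neg hz.1 hz.2).ne) fun z hz => ?_
  rw [interior_Ioo] at hz
  have hs := sinq_neg hz.1 hz.2
  have hz0 : 0 < z := hpi.trans hz.1
  rw [(hasDerivAt_pq_div_sinq hz0.ne' hs.ne).deriv]
  have := one_add_sinq_mul_cosq_pos_of_gt hz.1
  have h3 : 0 < sinq z ^ 2 := sq_pos_of_neg hs
  positivity

theorem strictAntiOn_cosq : StrictAntiOn cosq (Iic (Real.pi ^ 2)) := by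
  refine strictAntiOn_of_deriv_neg (convex_Iic _) continuous_cosq.continuousOn fun z hz => ?_
  rw [interior_Iic] at hz
  rw [(hasDerivAt_cosq z).deriv]
  have := sinq_pos hz
  linarith

theorem cosq_le_one_of_nonneg {z : ℝ} (hz : 0 ≤ z) : cosq z ≤ 1 := by
  rw [cosq, if_pos hz]; exact Real.cos_le_one _

/-! ### Secant lines of the curve `(cosq, sinq)`. -/

theorem hasDerivAt_sinq_sub_mul_cosq (m z : ℝ) :
    HasDerivAt (fun z => sinq z - m * cosq z) ((m * sinq z - pq z) / 2) z := by
  refine ((hasDerivAt_sinq z).sub ((hasDerivAt_cosq z).const_mul m)).congr_deriv ?_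
  ring

theorem div_sinq_eq {m z : ℝ} (hs : sinq z ≠ 0) (h : m * sinq z = pq z) : pq z / sinq z = m := by
  rw [← h]; field_simp

/-- Critical points of `F = sinq - m cosq` solve `pq / sinq = m`. Below `π²` there is at most one,
and `π²` is never one. Beyond a critical point in `(π², 4π²)`, `F` increases strictly up to `F (4π²)
= -m`, which contradicts `F C > -m`. -/
theorem false_of_two_critical {m x₁ x₂ C : ℝ} (h12 : x₁ < x₂) (h1 : m * sinq x₁ = pq x₁)
    (h2 : m * sinq x₂ = pq x₂) (hC : x₂ ≤ C) (hC' : C < 4 * Real.pi ^ 2)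
    (hend : -m < sinq C - m * cosq C) : False := by
  rcases lt_trichotomy x₂ (Real.pi ^ 2) with h | h | h
  · have := strictMonoOn_pq_div_sinq_Iio (h12.trans h) h h12
    simp only [div_sinq_eq (sinq_pos h).ne' h2, div_sinq_eq (sinq_pos (h12.trans h)).ne' h1] at this
    exact lt_irrefl _ this
  · rw [h, sinq_pi_sq, mul_zero] at h2
    exact pq_pi_sq_ne_zero h2.symm
  · have hx2 := hC.trans_lt hC'
    have hm : StrictMonoOn (fun z => sinq z - m * cosq z) (Icc x₂ (4 * Real.pi ^ 2)) := by
      refine strictMonoOn_of_deriv_pos (convex_Icc _ _)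
        (fun z _ => (hasDerivAt_sinq_sub_mul_cosq m z).continuousAt.continuousWithinAt)
        fun z hz => ?_
      rw [interior_Icc] at hz
      rw [(hasDerivAt_sinq_sub_mul_cosq m z).deriv]
      have hlt := strictMonoOn_pq_div_sinq_Ioo ⟨h, hx2⟩ ⟨h.trans hz.1, hz.2⟩ hz.1
      have hs := sinq_neg (h.trans hz.1) hz.2
      simp only [div_sinq_eq (sinq_neg h hx2).ne h2] at hlt
      rw [lt_div_iff_of_neg hs] at hlt
      linarith
    have := hm ⟨hC, hC'.le⟩ (right_mem_Icc.2 hx2.le) hC'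
    simp only [sinq_four_pi_sq, cosq_four_pi_sq] at this
    linarith

theorem exists_critical {m a b : ℝ} (hab : a < b)
    (h : sinq a - m * cosq a = sinq b - m * cosq b) : ∃ x ∈ Ioo a b, m * sinq x = pq x := by
  obtain ⟨x, hx, h⟩ := exists_hasDerivAt_eq_zero hab
    (fun z _ => (hasDerivAt_sinq_sub_mul_cosq m z).continuousAt.continuousWithinAt) h
    (fun z _ => hasDerivAt_sinq_sub_mul_cosq m z)
  exact ⟨x, hx, by linarith⟩

/-- `z` is a second intersection, counted with multiplicity, of the curve `(cosq, sinq)` with the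
line of slope `m` through its point of parameter `w`. -/
def SecantAt (m w z : ℝ) : Prop :=
  sinq z - m * cosq z = sinq w - m * cosq w ∧ (z = w → m * sinq w = pq w)

/-- The parameters `w`, `z₁`, `z₂` carry the same value of `sinq - m cosq`. Rolle between
neighbours, or tangency where two of them coincide, gives two critical points up to the largest of
the three. The cases list the possible orders. -/
theorem SecantAt.not_param_lt {m w z₁ z₂ : ℝ} (hend : -m < sinq w - m * cosq w)
    (hw : w < 4 * Real.pi ^ 2) (hz : z₂ < 4 * Real.pi ^ 2) (h1 : SecantAt m w z₁)
    (h2 : SecantAt m w z₂) : ¬ z₁ < z₂ := by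
  intro hlt
  rcases lt_trichotomy w z₁ with hw1 | hw1 | hw1
  · obtain ⟨x, hx, hx'⟩ := exists_critical hw1 h1.1.symm
    obtain ⟨y, hy, hy'⟩ := exists_critical hlt (h1.1.trans h2.1.symm)
    exact false_of_two_critical (hx.2.trans hy.1) hx' hy' hy.2.le hz (by rw [h2.1]; exact hend)
  · obtain ⟨y, hy, hy'⟩ := exists_critical hlt (h1.1.trans h2.1.symm)
    have hx' := h1.2 hw1.symm
    exact false_of_two_critical (hw1.trans_lt hy.1) hx' hy' hy.2.le hz (by rw [h2.1]; exact hend)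
  · obtain ⟨x, hx, hx'⟩ := exists_critical hw1 h1.1
    rcases lt_trichotomy w z₂ with hw2 | hw2 | hw2
    · obtain ⟨y, hy, hy'⟩ := exists_critical hw2 h2.1.symm
      exact false_of_two_critical (hx.2.trans hy.1) hx' hy' hy.2.le hz (by rw [h2.1]; exact hend)
    · have hy' := h2.2 hw2.symm
      exact false_of_two_critical hx.2 hx' hy' le_rfl hw hend
    · obtain ⟨x, hx, hx'⟩ := exists_critical hlt (h1.1.trans h2.1.symm)
      obtain ⟨y, hy, hy'⟩ := exists_critical hw2 h2.1
      exact false_of_two_critical (hx.2.trans hy.1) hx' hy' hy.2.le hw hend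

/-- After multiplication by `|h|` this follows from `sinh |h| - (cosh |h| - 1) = 1 - e^{-|h|} > 0`.
-/
theorem neg_lt_sinq_sub_of_abs_mul_lt_one {h m : ℝ} (hh : h ≠ 0) (hm : |h * m| < 1) :
    -m < sinq (-h ^ 2) - m * cosq (-h ^ 2) := by
  have hs := mul_sinq_neg_sq |h|
  rw [sq_abs] at hs
  have hpos : 0 < |h| := abs_pos.2 hh
  have hc : cosq (-h ^ 2) = Real.cosh |h| := by rw [cosq_neg_sq, Real.cosh_abs]
  have h1 := Real.one_le_cosh |h|
  have h2 : Real.cosh |h| - Real.sinh |h| < 1 := by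
    rw [Real.cosh_sub_sinh]; rw [← Real.exp_zero]
    exact Real.exp_lt_exp.2 (by linarith)
  have h3 : |h| * m ≤ 1 := by
    rw [abs_mul] at hm
    exact (mul_le_mul_of_nonneg_left (le_abs_self m) hpos.le).trans hm.le
  rw [hc]
  have h4 : |h| * m * (Real.cosh |h| - 1) ≤ Real.cosh |h| - 1 := by nlinarith
  have h5 : 0 < |h| * (sinq (-h ^ 2) - m * (Real.cosh |h| - 1)) := by
    rw [mul_sub, hs]; nlinarith
  have := pos_of_mul_pos_right h5 hpos.le
  linarith

theorem SecantAt.param_eq {h m z₁ z₂ : ℝ} (hh : h ≠ 0) (hm : |h * m| < 1)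
    (hz₁ : z₁ < 4 * Real.pi ^ 2) (hz₂ : z₂ < 4 * Real.pi ^ 2) (h1 : SecantAt m (-h ^ 2) z₁)
    (h2 : SecantAt m (-h ^ 2) z₂) : z₁ = z₂ := by
  have hend := neg_lt_sinq_sub_of_abs_mul_lt_one hh hm
  have hw : -h ^ 2 < 4 * Real.pi ^ 2 := by
    have := sq_nonneg h
    have := Real.pi_pos
    nlinarith
  exact le_antisymm (not_lt.1 (h2.not_param_lt hend hw hz₁ h1)) (not_lt.1 (h1.not_param_lt hend hw hz₂ h2))

/-! ### The explicit flow of one linear system. -/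

/-- The solution of `S'' = T S' - D S`, `S 0 = 0`, `S' 0 = 1`. -/
noncomputable def flowS (T D t : ℝ) : ℝ := Real.exp (T / 2 * t) * sn (D - T ^ 2 / 4) t

/-- The derivative of `flowS`. -/
noncomputable def flowS' (T D t : ℝ) : ℝ :=
  Real.exp (T / 2 * t) * (T / 2 * sn (D - T ^ 2 / 4) t + cn (D - T ^ 2 / 4) t)

/-- The solution of `φ'' = T φ' - D φ + 1`, `φ 0 = φ' 0 = 0`. -/
noncomputable def flowP (T D t : ℝ) : ℝ := ∫ u in (0 : ℝ)..t, flowS T D u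

theorem hasDerivAt_exp_half (T t : ℝ) :
    HasDerivAt (fun t => Real.exp (T / 2 * t)) (T / 2 * Real.exp (T / 2 * t)) t := by
  refine (((hasDerivAt_id t).const_mul (T / 2)).exp).congr_deriv ?_
  simp; ring

theorem hasDerivAt_flowS (T D t : ℝ) : HasDerivAt (flowS T D) (flowS' T D t) t := by
  refine ((hasDerivAt_exp_half T t).mul (hasDerivAt_sn (D - T ^ 2 / 4) t)).congr_deriv ?_
  rw [flowS']; ring

theorem hasDerivAt_flowS' (T D t : ℝ) :
    HasDerivAt (flowS' T D) (T * flowS' T D t - D * flowS T D t) t := by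
  refine ((hasDerivAt_exp_half T t).mul (((hasDerivAt_sn (D - T ^ 2 / 4) t).const_mul (T / 2)).add
    (hasDerivAt_cn (D - T ^ 2 / 4) t))).congr_deriv ?_
  simp only [flowS', flowS, Pi.add_apply]; ring

theorem continuous_flowS (T D : ℝ) : Continuous (flowS T D) :=
  continuous_iff_continuousAt.2 fun t => (hasDerivAt_flowS T D t).continuousAt

theorem continuous_flowS' (T D : ℝ) : Continuous (flowS' T D) :=
  continuous_iff_continuousAt.2 fun t => (hasDerivAt_flowS' T D t).continuousAt

theorem hasDerivAt_flowP (T D t : ℝ) : HasDerivAt (flowP T D) (flowS T D t) t :=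
  intervalIntegral.integral_hasDerivAt_right ((continuous_flowS T D).intervalIntegrable _ _)
    ((continuous_flowS T D).stronglyMeasurableAtFilter _ _) (continuous_flowS T D).continuousAt

theorem continuous_flowP (T D : ℝ) : Continuous (flowP T D) :=
  continuous_iff_continuousAt.2 fun t => (hasDerivAt_flowP T D t).continuousAt

theorem flowS_zero (T D : ℝ) : flowS T D 0 = 0 := by simp [flowS, sn_zero]
theorem flowS'_zero (T D : ℝ) : flowS' T D 0 = 1 := by simp [flowS', sn_zero, cn_zero]
theorem flowP_zero (T D : ℝ) : flowP T D 0 = 0 := by simp [flowP]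

/-- Two functions with the same derivative and the same value at `0` agree. -/
theorem eq_of_hasDerivAt_eq {f g f' : ℝ → ℝ} (hf : ∀ t, HasDerivAt f (f' t) t)
    (hg : ∀ t, HasDerivAt g (f' t) t) (h0 : f 0 = g 0) (t : ℝ) : f t = g t := by
  have h : ∀ t, HasDerivAt (fun t => f t - g t) 0 t := fun t =>
    ((hf t).sub (hg t)).congr_deriv (sub_self _)
  have := is_const_of_deriv_eq_zero (fun t => (h t).differentiableAt) (fun t => (h t).deriv) t 0
  simp only [h0, sub_self] at this
  linarith

theorem mul_flowP (T D t : ℝ) : D * flowP T D t = 1 - flowS' T D t + T * flowS T D t := by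
  refine eq_of_hasDerivAt_eq (f := fun t => D * flowP T D t)
    (g := fun t => 1 - flowS' T D t + T * flowS T D t) (f' := fun t => D * flowS T D t)
    (fun t => (hasDerivAt_flowP T D t).const_mul D) (fun t => ?_) ?_ t
  · refine (((hasDerivAt_flowS' T D t).const_sub 1).add
      ((hasDerivAt_flowS T D t).const_mul T)).congr_deriv ?_
    ring
  · simp [flowS_zero, flowS'_zero, flowP_zero]

/-- Needed because `mul_flowP` no longer determines `flowP` when `D = 0`. -/
theorem mul_flowP_of_det_zero (T t : ℝ) : T * flowP T 0 t = flowS T 0 t - t := by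
  refine eq_of_hasDerivAt_eq (f := fun t => T * flowP T 0 t)
    (g := fun t => flowS T 0 t - t) (f' := fun t => T * flowS T 0 t)
    (fun t => (hasDerivAt_flowP T 0 t).const_mul T) (fun t => ?_) ?_ t
  · refine ((hasDerivAt_flowS T 0 t).sub (hasDerivAt_id t)).congr_deriv ?_
    have := mul_flowP T 0 t
    linarith
  · simp [flowS_zero, flowP_zero]

theorem flowS_neg (T D t : ℝ) : flowS (-T) D t = Real.exp (-(T * t)) * flowS T D t := by
  rw [flowS, flowS, ← mul_assoc, ← Real.exp_add, neg_sq]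
  congr 2; ring

/-- The left side is the numerator of `(flowP / flowS)'`; the right side gives its sign through the
time-reversed system. After multiplication by `e^{-T t}` both sides have derivative `flowS (-T) D`.
-/
theorem flowS_sq_sub (T D t : ℝ) :
    flowS T D t ^ 2 - flowP T D t * flowS' T D t = Real.exp (T * t) * flowP (-T) D t := by
  have h := eq_of_hasDerivAt_eq
    (f := fun t => Real.exp (-(T * t)) * (flowS T D t ^ 2 - flowP T D t * flowS' T D t))
    (g := flowP (-T) D) (f' := flowS (-T) D) (fun t => ?_) (hasDerivAt_flowP (-T) D) ?_ t
  · rw [← h, ← mul_assoc, ← Real.exp_add]; simp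
  · have he : HasDerivAt (fun t => Real.exp (-(T * t))) (-T * Real.exp (-(T * t))) t := by
      refine (((hasDerivAt_id t).const_mul T).neg.exp).congr_deriv ?_
      simp; ring
    refine (he.mul (((hasDerivAt_flowS T D t).pow 2).sub
      ((hasDerivAt_flowP T D t).mul (hasDerivAt_flowS' T D t)))).congr_deriv ?_
    rw [flowS_neg]
    have := mul_flowP T D t
    simp
    linear_combination Real.exp (-(T * t)) * flowS T D t * this
  · simp [flowS_zero, flowS'_zero, flowP_zero]

theorem flow_wronskian (T D t : ℝ) :
    flowS' T D t ^ 2 - T * flowS T D t * flowS' T D t + D * flowS T D t ^ 2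
      = Real.exp (T * t) := by
  have h1 := cn_sq_add (D - T ^ 2 / 4) t
  have h2 : Real.exp (T * t) = Real.exp (T / 2 * t) ^ 2 := by
    rw [← Real.exp_nat_mul]; congr 1; push_cast; ring
  rw [h2, flowS, flowS']
  linear_combination Real.exp (T / 2 * t) ^ 2 * h1

/-- The abscissa at time `t` of the orbit of `(0, y)`. -/
noncomputable def flowX (T D a y t : ℝ) : ℝ := a * flowP T D t - y * flowS T D t

/-- The time derivative of `flowX`. -/
noncomputable def flowX' (T D a y t : ℝ) : ℝ := a * flowS T D t - y * flowS' T D t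

/-- The ordinate at time `t` of the orbit of `(0, y)`. -/
noncomputable def flowY (T D a y t : ℝ) : ℝ := T * flowX T D a y t - flowX' T D a y t

theorem hasDerivAt_flowX (T D a y t : ℝ) :
    HasDerivAt (flowX T D a y) (flowX' T D a y t) t :=
  ((hasDerivAt_flowP T D t).const_mul a).sub ((hasDerivAt_flowS T D t).const_mul y)

theorem hasDerivAt_flowX' (T D a y t : ℝ) :
    HasDerivAt (flowX' T D a y) (T * flowX' T D a y t - D * flowX T D a y t + a) t := by
  refine (((hasDerivAt_flowS T D t).const_mul a).sub
    ((hasDerivAt_flowS' T D t).const_mul y)).congr_deriv ?_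
  have := mul_flowP T D t
  rw [flowX', flowX]
  linear_combination a * this

theorem isLinearOrbit_flow (T D a y : ℝ) :
    LienardPWL.IsLinearOrbit T D a (flowX T D a y) (flowY T D a y) := by
  intro t
  constructor
  · exact (hasDerivAt_flowX T D a y t).congr_deriv (by rw [flowY]; ring)
  · refine (((hasDerivAt_flowX T D a y t).const_mul T).sub
      (hasDerivAt_flowX' T D a y t)).congr_deriv ?_
    ring

theorem flowX_zero (T D a y : ℝ) : flowX T D a y 0 = 0 := by
  simp [flowX, flowS_zero, flowP_zero]

theorem flowX'_zero (T D a y : ℝ) : flowX' T D a y 0 = -y := by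
  simp [flowX', flowS_zero, flowS'_zero]

theorem flowY_zero (T D a y : ℝ) : flowY T D a y 0 = y := by
  simp [flowY, flowX_zero, flowX'_zero]

/-- The linear vector field is Lipschitz. -/
theorem exists_lipschitzWith_field (T D a : ℝ) :
    ∃ K, LipschitzWith K fun p : ℝ × ℝ => (T * p.1 - p.2, D * p.1 - a) := by
  let L : ℝ × ℝ →L[ℝ] ℝ × ℝ :=
    (T • ContinuousLinearMap.fst ℝ ℝ ℝ - ContinuousLinearMap.snd ℝ ℝ ℝ).prod
      (D • ContinuousLinearMap.fst ℝ ℝ ℝ)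
  have h : (fun p : ℝ × ℝ => (T * p.1 - p.2, D * p.1 - a)) = fun p => L p + ((0 : ℝ), -a) := by
    funext p
    simp [L, sub_eq_add_neg]
  rw [h]
  exact ⟨_, L.lipschitz.add (LipschitzWith.const _)⟩

/-- Only right derivatives are required, since the ordinate of a crossing solution may have a corner
on the switching line. -/
theorem eqOn_flow {T D a y τ : ℝ} {x' y' : ℝ → ℝ} (hx : ContinuousOn x' (Icc 0 τ))
    (hy : ContinuousOn y' (Icc 0 τ))
    (hd : ∀ t ∈ Ico 0 τ, HasDerivWithinAt x' (T * x' t - y' t) (Ici t) t ∧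
      HasDerivWithinAt y' (D * x' t - a) (Ici t) t) (hx0 : x' 0 = 0) (hy0 : y' 0 = y) :
    ∀ t ∈ Icc 0 τ, x' t = flowX T D a y t ∧ y' t = flowY T D a y t := by
  obtain ⟨K, hK⟩ := exists_lipschitzWith_field T D a
  have hF := isLinearOrbit_flow T D a y
  have := ODE_solution_unique (v := fun _ p => (T * p.1 - p.2, D * p.1 - a))
    (f := fun t => (x' t, y' t)) (g := fun t => (flowX T D a y t, flowY T D a y t))
    (fun _ => hK) (hx.prodMk hy) (fun t ht => (hd t ht).1.prodMk (hd t ht).2)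
    (fun t _ => ((hF t).1.continuousAt.prodMk (hF t).2.continuousAt).continuousWithinAt)
    (fun t _ => ((hF t).1.prodMk (hF t).2).hasDerivWithinAt)
    (by simp [hx0, hy0, flowX_zero, flowY_zero])
  intro t ht
  simpa using this ht

theorem LienardPWL.IsLinearOrbit.eq_flow {T D a y : ℝ} {x' y' : ℝ → ℝ}
    (h : LienardPWL.IsLinearOrbit T D a x' y') (hx0 : x' 0 = 0) (hy0 : y' 0 = y) :
    x' = flowX T D a y ∧ y' = flowY T D a y := by
  obtain ⟨K, hK⟩ := exists_lipschitzWith_field T D a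
  have hF := isLinearOrbit_flow T D a y
  have := ODE_solution_unique_univ (v := fun _ p => (T * p.1 - p.2, D * p.1 - a))
    (f := fun t => (x' t, y' t)) (g := fun t => (flowX T D a y t, flowY T D a y t))
    (s := fun _ => univ) (t₀ := 0)
    (fun _ => hK.lipschitzOnWith) (fun t => ⟨(h t).1.prodMk (h t).2, trivial⟩)
    (fun t => ⟨(hF t).1.prodMk (hF t).2, trivial⟩)
    (by simp [hx0, hy0, flowX_zero, flowY_zero])
  constructor <;> funext t
  · exact congrArg Prod.fst (congrFun this t)
  · exact congrArg Prod.snd (congrFun this t)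

/-! ### Returns to the switching line and their symmetries. -/

/-- The forward orbit of `(0, y₀)` through `x < 0` first returns to `x = 0` at time `τ`, with
ordinate `y₁`. -/
structure Ret (T D a y₀ y₁ τ : ℝ) : Prop where
  pos : 0 < τ
  zero : flowX T D a y₀ τ = 0
  val : flowY T D a y₀ τ = y₁
  neg : ∀ t ∈ Ioo 0 τ, flowX T D a y₀ t < 0

theorem Ret.of_orbit {T D a y₀ y₁ τ : ℝ} {x y : ℝ → ℝ} (h : LienardPWL.IsLinearOrbit T D a x y)
    (hx0 : x 0 = 0) (hy0 : y 0 = y₀) (hτ : 0 < τ) (hx : x τ = 0) (hy : y τ = y₁)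
    (hn : ∀ t ∈ Ioo 0 τ, x t < 0) : Ret T D a y₀ y₁ τ := by
  obtain ⟨rfl, rfl⟩ := h.eq_flow hx0 hy0
  exact ⟨hτ, hx, hy, hn⟩

theorem Ret.time_unique {T D a y₀ y₁ y₂ τ σ : ℝ} (h : Ret T D a y₀ y₁ τ)
    (h' : Ret T D a y₀ y₂ σ) : τ = σ := by
  rcases lt_trichotomy τ σ with hlt | h0 | hlt
  · exact absurd h.zero (h'.neg τ ⟨h.pos, hlt⟩).ne
  · exact h0
  · exact absurd h'.zero (h.neg σ ⟨h'.pos, hlt⟩).ne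

theorem Ret.unique {T D a y₀ y₁ y₂ τ σ : ℝ} (h : Ret T D a y₀ y₁ τ)
    (h' : Ret T D a y₀ y₂ σ) : y₁ = y₂ := by
  rw [← h.val, ← h'.val, h.time_unique h']

/-- Time reversal with reflection in the abscissa axis. -/
theorem LienardPWL.IsLinearOrbit.reverse {T D a : ℝ} {x y : ℝ → ℝ}
    (h : LienardPWL.IsLinearOrbit T D a x y) (τ : ℝ) :
    LienardPWL.IsLinearOrbit (-T) D a (fun t => x (τ - t)) (fun t => -y (τ - t)) := by
  intro t
  have h1 := (h (τ - t)).1.scomp t ((hasDerivAt_id t).const_sub τ)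
  have h2 := ((h (τ - t)).2.scomp t ((hasDerivAt_id t).const_sub τ)).neg
  exact ⟨h1.congr_deriv (by simp; ring), h2.congr_deriv (by simp)⟩

/-- Time reversal with reflection in the switching line. -/
theorem LienardPWL.IsLinearOrbit.reflect {T D a : ℝ} {x y : ℝ → ℝ}
    (h : LienardPWL.IsLinearOrbit T D a x y) :
    LienardPWL.IsLinearOrbit (-T) D (-a) (fun t => -x (-t)) (fun t => y (-t)) := by
  intro t
  have h1 := ((h (-t)).1.scomp t (hasDerivAt_neg t)).neg
  have h2 := (h (-t)).2.scomp t (hasDerivAt_neg t)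
  exact ⟨h1.congr_deriv (by simp), h2.congr_deriv (by simp; ring)⟩

/-- Change of time scale. -/
theorem LienardPWL.IsLinearOrbit.scale {T D a : ℝ} {x y : ℝ → ℝ}
    (h : LienardPWL.IsLinearOrbit T D a x y) {r : ℝ} (hr : 0 < r) :
    LienardPWL.IsLinearOrbit (r * T) (r ^ 2 * D) (r * a) (fun t => x (r * t) / r)
      (fun t => y (r * t)) := by
  intro t
  have h1 := ((h (r * t)).1.scomp t ((hasDerivAt_id t).const_mul r)).div_const r
  have h2 := (h (r * t)).2.scomp t ((hasDerivAt_id t).const_mul r)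
  refine ⟨h1.congr_deriv ?_, h2.congr_deriv ?_⟩
  · simp; field_simp
  · simp; field_simp

theorem Ret.reverse {T D a y₀ y₁ τ : ℝ} (h : Ret T D a y₀ y₁ τ) :
    Ret (-T) D a (-y₁) (-y₀) τ := by
  refine Ret.of_orbit ((isLinearOrbit_flow T D a y₀).reverse τ) (by simp [h.zero])
    (by simp [h.val]) h.pos (by simp [flowX_zero]) (by simp [flowY_zero]) fun t ht => ?_
  exact h.neg _ ⟨by linarith [ht.2], by linarith [ht.1]⟩

theorem Ret.scale {T D a y₀ y₁ τ : ℝ} (h : Ret T D a y₀ y₁ τ) {r : ℝ} (hr : 0 < r) :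
    Ret (r * T) (r ^ 2 * D) (r * a) y₀ y₁ (τ / r) := by
  have hrt : r * (τ / r) = τ := by field_simp
  refine Ret.of_orbit ((isLinearOrbit_flow T D a y₀).scale hr) (by simp [flowX_zero])
    (by simp [flowY_zero]) (div_pos h.pos hr) (by simp [hrt, h.zero])
    (by simp [hrt, h.val]) fun t ht => ?_
  refine div_neg_of_neg_of_pos (h.neg _ ⟨mul_pos hr ht.1, ?_⟩) hr
  have := (lt_div_iff₀ hr).1 ht.2
  linarith

namespace LienardPWL

theorem leftReturn_iff (S : LienardPWL) (y₀ y₁ : ℝ) :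
    S.LeftReturn y₀ y₁ ↔ ∃ τ, Ret S.TL S.DL S.aL y₀ y₁ τ := by
  constructor
  · rintro ⟨x, y, h, hx0, hy0, τ, hτ, hx, hy, hn⟩
    exact ⟨τ, Ret.of_orbit h hx0 hy0 hτ hx hy hn⟩
  · rintro ⟨τ, h⟩
    exact ⟨_, _, isLinearOrbit_flow _ _ _ y₀, flowX_zero _ _ _ _, flowY_zero _ _ _ _, τ, h.pos,
      h.zero, h.val, h.neg⟩

theorem rightReturn_iff (S : LienardPWL) (y₀ y₁ : ℝ) :
    S.RightReturn y₀ y₁ ↔ ∃ τ, Ret (-S.TR) S.DR (-S.aR) y₀ y₁ τ := by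
  constructor
  · rintro ⟨x, y, h, hx0, hy0, τ, hτ, hx, hy, hn⟩
    refine ⟨-τ, Ret.of_orbit h.reflect (by simp [hx0]) (by simp [hy0]) (by linarith)
      (by simp [hx]) (by simp [hy]) fun t ht => ?_⟩
    have := hn (-t) ⟨by linarith [ht.2], by linarith [ht.1]⟩
    linarith
  · rintro ⟨τ, h⟩
    have ho := (isLinearOrbit_flow (-S.TR) S.DR (-S.aR) y₀).reflect
    rw [neg_neg, neg_neg] at ho
    refine ⟨_, _, ho, by simp [flowX_zero], by simp [flowY_zero], -τ, by linarith [h.pos],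
      by simp [h.zero], by simp [h.val], fun t ht => ?_⟩
    have := h.neg (-t) ⟨by linarith [ht.2], by linarith [ht.1]⟩
    linarith

end LienardPWL

/-! ### Bounds on the return time. -/

theorem flowS_eq (T D t : ℝ) :
    flowS T D t = Real.exp (T / 2 * t) * (t * sinq ((D - T ^ 2 / 4) * t ^ 2)) := rfl

theorem flowS'_eq (T D t : ℝ) :
    flowS' T D t = Real.exp (T / 2 * t) *
      (T / 2 * t * sinq ((D - T ^ 2 / 4) * t ^ 2) + cosq ((D - T ^ 2 / 4) * t ^ 2)) := by
  rw [flowS', sn, cn]; ring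

theorem flowS_pos {T D t : ℝ} (ht : 0 < t) (h : (D - T ^ 2 / 4) * t ^ 2 < Real.pi ^ 2) :
    0 < flowS T D t :=
  mul_pos (Real.exp_pos _) (sn_pos ht h)

theorem flowS_neg_of_lt {T D t : ℝ} (ht : 0 < t) (h : Real.pi ^ 2 < (D - T ^ 2 / 4) * t ^ 2)
    (h' : (D - T ^ 2 / 4) * t ^ 2 < 4 * Real.pi ^ 2) : flowS T D t < 0 :=
  mul_neg_of_pos_of_neg (Real.exp_pos _) (mul_neg_of_pos_of_neg ht (sinq_neg h h'))

theorem mul_sq_lt_of_lt {z u t : ℝ} (hu : 0 < u) (hut : u < t)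
    (h : z * t ^ 2 ≤ Real.pi ^ 2) : z * u ^ 2 < Real.pi ^ 2 := by
  have hpi : 0 < Real.pi ^ 2 := by positivity
  rcases le_or_gt z 0 with hz | hz
  · have := mul_nonpos_of_nonpos_of_nonneg hz (sq_nonneg u)
    linarith
  · have : u ^ 2 < t ^ 2 := by nlinarith
    nlinarith

theorem flowP_pos {T D t : ℝ} (ht : 0 < t) (h : (D - T ^ 2 / 4) * t ^ 2 ≤ Real.pi ^ 2) :
    0 < flowP T D t :=
  pos_of_deriv_pos (hasDerivAt_flowP T D) (flowP_zero T D) ht fun _ hu =>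
    flowS_pos hu.1 (mul_sq_lt_of_lt hu.1 hu.2 h)

theorem exists_time_of_le {z k τ : ℝ} (hτ : 0 < τ) (hk : 0 < k) (h : k ^ 2 ≤ z * τ ^ 2) :
    ∃ t, 0 < t ∧ t ≤ τ ∧ z * t ^ 2 = k ^ 2 := by
  have hz : 0 < z := by
    by_contra hz
    have := mul_nonpos_of_nonpos_of_nonneg (not_lt.1 hz) (sq_nonneg τ)
    have : 0 < k ^ 2 := by positivity
    linarith
  have hs : 0 < √z := Real.sqrt_pos.2 hz
  refine ⟨k / √z, by positivity, ?_, ?_⟩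
  · rw [div_le_iff₀ hs]
    refine abs_le_of_sq_le_sq' ?_ (by positivity) |>.2
    rw [mul_pow, Real.sq_sqrt hz.le]; linarith
  · rw [div_pow, Real.sq_sqrt hz.le]; field_simp

namespace Ret

variable {T D a y₀ y₁ τ : ℝ}

theorem rel (h : Ret T D a y₀ y₁ τ) : y₀ * flowS T D τ = a * flowP T D τ := by
  have := h.zero
  rw [flowX] at this
  linarith

theorem deriv_end (h : Ret T D a y₀ y₁ τ) : flowX' T D a y₀ τ = -y₁ := by
  have := h.val
  rw [flowY, h.zero] at this
  linarith

theorem nonpos (h : Ret T D a y₀ y₁ τ) {t : ℝ} (ht : 0 < t) (ht' : t ≤ τ) :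
    flowX T D a y₀ t ≤ 0 := by
  rcases ht'.eq_or_lt with rfl | h'
  · exact h.zero.le
  · exact (h.neg t ⟨ht, h'⟩).le

/-- At the time where `z t² = π²` (with `z = D - T² / 4`) `flowS` vanishes, so the abscissa is `a *
flowP > 0`, which is impossible before or at the return. -/
theorem sq_lt_of_pos (h : Ret T D a y₀ y₁ τ) (ha : 0 < a) :
    (D - T ^ 2 / 4) * τ ^ 2 < Real.pi ^ 2 := by
  by_contra hc
  obtain ⟨t, ht, htτ, hz⟩ := exists_time_of_le h.pos Real.pi_pos (not_lt.1 hc)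
  have h1 := h.nonpos ht htτ
  have hP := flowP_pos (T := T) (D := D) ht hz.le
  rw [flowX, flowS_eq, hz, sinq_pi_sq] at h1
  nlinarith

theorem sq_eq_of_zero (h : Ret T D 0 y₀ y₁ τ) (hy : 0 < y₀) :
    (D - T ^ 2 / 4) * τ ^ 2 = Real.pi ^ 2 := by
  rcases lt_trichotomy ((D - T ^ 2 / 4) * τ ^ 2) (Real.pi ^ 2) with hc | hc | hc
  · have h1 := h.rel
    have h2 := mul_pos hy (flowS_pos (T := T) h.pos hc)
    linarith
  · exact hc
  · obtain ⟨t, ht, htτ, hz⟩ := exists_time_of_le h.pos Real.pi_pos hc.le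
    have hlt : t < τ := lt_of_le_of_ne htτ (by rintro rfl; linarith)
    have h1 := h.neg t ⟨ht, hlt⟩
    rw [flowX, flowS_eq, hz, sinq_pi_sq] at h1
    simp at h1

theorem lt_sq_of_neg (h : Ret T D a y₀ y₁ τ) (hy : 0 < y₀) (ha : a < 0) :
    Real.pi ^ 2 < (D - T ^ 2 / 4) * τ ^ 2 := by
  by_contra hc
  have hc := not_lt.1 hc
  have hP := flowP_pos (T := T) (D := D) h.pos hc
  have hS : 0 ≤ flowS T D τ := by
    rcases hc.eq_or_lt with he | hl
    · rw [flowS_eq, he, sinq_pi_sq]; simp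
    · exact (flowS_pos h.pos hl).le
  have h1 := h.rel
  have h2 := mul_nonneg hy.le hS
  have h3 := mul_neg_of_neg_of_pos ha hP
  linarith

/-- At the full-turn time `t`, `flowS = 0` and `flowS' = e^{T t / 2} ≥ 1`, hence `flowP ≤ 0` and the
abscissa is nonnegative. The return must be exactly at `t`, but a full turn brings the orbit back
with a positive ordinate. Time reversal covers `T ≤ 0`. -/
theorem sq_lt_aux (h : Ret T D a y₀ y₁ τ) (hy : 0 < y₀) (hy' : y₁ < 0) (ha : a < 0)
    (hT : 0 ≤ T) : (D - T ^ 2 / 4) * τ ^ 2 < 4 * Real.pi ^ 2 := by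
  by_contra hc
  have hpi := Real.pi_pos
  obtain ⟨t, ht, htτ, hz⟩ := exists_time_of_le (k := 2 * Real.pi) h.pos (by positivity)
    (by nlinarith [not_lt.1 hc] : (2 * Real.pi) ^ 2 ≤ (D - T ^ 2 / 4) * τ ^ 2)
  rw [show (2 * Real.pi) ^ 2 = 4 * Real.pi ^ 2 by ring] at hz
  have hS : flowS T D t = 0 := by rw [flowS_eq, hz, sinq_four_pi_sq]; simp
  have hS' : flowS' T D t = Real.exp (T / 2 * t) := by
    rw [flowS'_eq, hz, sinq_four_pi_sq, cosq_four_pi_sq]; simp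
  have hexp : 1 ≤ flowS' T D t := by rw [hS']; exact Real.one_le_exp (by positivity)
  have hD : 0 < D := by
    have h1 : 0 < (D - T ^ 2 / 4) * t ^ 2 := by rw [hz]; positivity
    have h2 := pos_of_mul_pos_left h1 (sq_nonneg t)
    nlinarith [sq_nonneg T]
  have hP : flowP T D t ≤ 0 := by
    have h1 := mul_flowP T D t
    rw [hS] at h1
    by_contra hn
    have := mul_pos hD (not_le.1 hn)
    linarith
  have hX : 0 ≤ flowX T D a y₀ t := by
    rw [flowX, hS]
    have := mul_nonneg_of_nonpos_of_nonpos ha.le hP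
    linarith
  have ht2 : t = τ := by
    by_contra hn
    exact absurd (h.neg t ⟨ht, lt_of_le_of_ne htτ hn⟩) (not_lt.2 hX)
  have h1 := h.deriv_end
  rw [← ht2, flowX', hS] at h1
  nlinarith

theorem sq_lt (h : Ret T D a y₀ y₁ τ) (hy : 0 < y₀) (hy' : y₁ < 0) :
    (D - T ^ 2 / 4) * τ ^ 2 < 4 * Real.pi ^ 2 := by
  have hpi : 0 < Real.pi ^ 2 := by positivity
  rcases lt_trichotomy a 0 with ha | rfl | ha
  · rcases le_total 0 T with hT | hT
    · exact h.sq_lt_aux hy hy' ha hT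
    · have := h.reverse.sq_lt_aux (by linarith) (by linarith) ha (by linarith)
      simpa using this
  · have := h.sq_eq_of_zero hy
    linarith
  · have := h.sq_lt_of_pos ha
    linarith

theorem flowS_ne_zero (h : Ret T D a y₀ y₁ τ) (hy : 0 < y₀) (hy' : y₁ < 0) (ha : a ≠ 0) :
    flowS T D τ ≠ 0 := by
  rcases ha.lt_or_gt with ha | ha
  · exact (flowS_neg_of_lt h.pos (h.lt_sq_of_neg hy ha) (h.sq_lt hy hy')).ne
  · exact (flowS_pos h.pos (h.sq_lt_of_pos ha)).ne'

end Ret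

/-! ### Monotonicity of the half-map. -/

theorem hasDerivAt_flowP_div (T D : ℝ) {t : ℝ} (hS : flowS T D t ≠ 0) :
    HasDerivAt (fun t => flowP T D t / flowS T D t)
      (Real.exp (T * t) * flowP (-T) D t / flowS T D t ^ 2) t := by
  refine ((hasDerivAt_flowP T D t).div (hasDerivAt_flowS T D t) hS).congr_deriv ?_
  rw [← flowS_sq_sub]; ring

theorem flowP_div_lt {T D t₁ t₂ : ℝ} (h12 : t₁ < t₂) (hS : ∀ t ∈ Icc t₁ t₂, flowS T D t ≠ 0)
    (hP : ∀ t ∈ Icc t₁ t₂, 0 < flowP (-T) D t) :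
    flowP T D t₁ / flowS T D t₁ < flowP T D t₂ / flowS T D t₂ := by
  have hm : StrictMonoOn (fun t => flowP T D t / flowS T D t) (Icc t₁ t₂) := by
    refine strictMonoOn_of_deriv_pos (convex_Icc _ _)
      (fun t ht => (hasDerivAt_flowP_div T D (hS t ht)).continuousAt.continuousWithinAt)
      fun t ht => ?_
    have ht := interior_subset ht
    rw [(hasDerivAt_flowP_div T D (hS t ht)).deriv]
    have := hP t ht
    have := pow_pos (abs_pos.2 (hS t ht)) 2
    rw [sq_abs] at this
    positivity
  exact hm (left_mem_Icc.2 h12.le) (right_mem_Icc.2 h12.le) h12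

namespace Ret

variable {T D a y₀ y₁ τ u₀ u₁ σ : ℝ}

/-- The closing relation `y₀ * flowS = a * flowP` makes `flowP` positive at `τ`, and `flowP`
decreases on `[t, τ]` because `flowS < 0` there. -/
theorem flowP_pos_of_neg (h : Ret T D a y₀ y₁ τ) (hy : 0 < y₀) (hy' : y₁ < 0) (ha : a < 0)
    {t : ℝ} (ht : 0 < t) (htτ : t ≤ τ) (hlt : Real.pi ^ 2 < (D - T ^ 2 / 4) * t ^ 2) :
    0 < flowP T D t := by
  have hτ := h.sq_lt hy hy'
  have hz : 0 < D - T ^ 2 / 4 := by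
    refine pos_of_mul_pos_left (lt_trans ?_ hlt) (sq_nonneg t)
    positivity
  have hend : 0 < flowP T D τ := by
    have h1 := h.rel
    have h2 := flowS_neg_of_lt h.pos (h.lt_sq_of_neg hy ha) hτ
    by_contra hn
    have := mul_neg_of_pos_of_neg hy h2
    have := mul_nonneg_of_nonpos_of_nonpos ha.le (not_lt.1 hn)
    linarith
  have hanti : AntitoneOn (flowP T D) (Icc t τ) := by
    refine antitoneOn_of_deriv_nonpos (convex_Icc _ _) (continuous_flowP T D).continuousOn
      (fun u _ => (hasDerivAt_flowP T D u).differentiableAt.differentiableWithinAt) fun u hu => ?_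
    rw [interior_Icc] at hu
    rw [(hasDerivAt_flowP T D u).deriv]
    have h1 : t ^ 2 < u ^ 2 := by nlinarith [hu.1]
    have h2 : u ^ 2 < τ ^ 2 := by nlinarith [hu.2, hu.1]
    exact (flowS_neg_of_lt (ht.trans hu.1) (by nlinarith) (by nlinarith)).le
  exact hend.trans_le (hanti (left_mem_Icc.2 htτ) (right_mem_Icc.2 htτ) htτ)

/-- On the interval between two return times, the quotients parametrizing the half-map are
monotone. -/
theorem quotient_lt (h : Ret T D a y₀ y₁ τ) (hy : 0 < y₀)
    (h' : Ret T D a u₀ u₁ σ) (hu : 0 < u₀) (hu' : u₁ < 0) (ha : a ≠ 0) (hlt : τ < σ) :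
    y₀ / a < u₀ / a := by
  have hS : ∀ t ∈ Icc τ σ, flowS T D t ≠ 0 := by
    intro t ht
    have ht0 : 0 < t := h.pos.trans_le ht.1
    rcases ha.lt_or_gt with ha | ha
    · have h1 := h.lt_sq_of_neg hy ha
      have h2 := h'.sq_lt hu hu'
      have hz : 0 < D - T ^ 2 / 4 :=
        pos_of_mul_pos_left (lt_trans (by positivity) h1) (sq_nonneg τ)
      have h3 : τ ^ 2 ≤ t ^ 2 := by nlinarith [ht.1, h.pos]
      have h4 : t ^ 2 ≤ σ ^ 2 := by nlinarith [ht.2, h.pos]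
      exact (flowS_neg_of_lt ht0 (by nlinarith) (by nlinarith)).ne
    · rcases ht.2.eq_or_lt with rfl | hts
      · exact (flowS_pos ht0 (h'.sq_lt_of_pos ha)).ne'
      · exact (flowS_pos ht0 (mul_sq_lt_of_lt ht0 hts (h'.sq_lt_of_pos ha).le)).ne'
  -- This is the sign of the derivative of `flowP / flowS`; for `a < 0` it is read off from the
  -- reversed return.
  have hP : ∀ t ∈ Icc τ σ, 0 < flowP (-T) D t := by
    intro t ht
    have ht0 : 0 < t := h.pos.trans_le ht.1
    rcases ha.lt_or_gt with ha | ha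
    · have h1 := h.lt_sq_of_neg hy ha
      have hz : 0 < D - T ^ 2 / 4 :=
        pos_of_mul_pos_left (lt_trans (by positivity) h1) (sq_nonneg τ)
      have h3 : τ ^ 2 ≤ t ^ 2 := by nlinarith [ht.1, h.pos]
      refine h'.reverse.flowP_pos_of_neg (by linarith) (by linarith) ha ht0 ht.2 ?_
      rw [neg_sq]
      nlinarith
    · refine flowP_pos ht0 ?_
      rw [neg_sq]
      rcases ht.2.eq_or_lt with rfl | hts
      · exact (h'.sq_lt_of_pos ha).le
      · exact (mul_sq_lt_of_lt ht0 hts (h'.sq_lt_of_pos ha).le).le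
  have key := flowP_div_lt hlt hS hP
  have e1 : y₀ / a = flowP T D τ / flowS T D τ := by
    rw [div_eq_div_iff ha (hS τ (left_mem_Icc.2 hlt.le)), h.rel]; ring
  have e2 : u₀ / a = flowP T D σ / flowS T D σ := by
    rw [div_eq_div_iff ha (hS σ (right_mem_Icc.2 hlt.le)), h'.rel]; ring
  rwa [e1, e2]

/-- The half-map is strictly decreasing. -/
theorem strictAnti (h : Ret T D a y₀ y₁ τ) (hy : 0 < y₀) (hy' : y₁ < 0)
    (h' : Ret T D a u₀ u₁ σ) (hu : 0 < u₀) (hu' : u₁ < 0) (hlt : y₀ < u₀) : u₁ < y₁ := by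
  rcases eq_or_ne a 0 with rfl | ha
  · have e1 := h.sq_eq_of_zero hy
    have e2 := h'.sq_eq_of_zero hu
    have hz : 0 < D - T ^ 2 / 4 := by
      refine pos_of_mul_pos_left ?_ (sq_nonneg τ)
      rw [e1]; positivity
    have hts : τ = σ := by
      have : τ ^ 2 = σ ^ 2 := mul_left_cancel₀ hz.ne' (e1.trans e2.symm)
      exact (sq_eq_sq₀ h.pos.le h'.pos.le).1 this
    have d1 := h.deriv_end
    have d2 := h'.deriv_end
    rw [← hts] at d2
    rw [flowX', zero_mul, zero_sub] at d1 d2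
    have hS' : flowS' T D τ < 0 := by
      by_contra hn
      have := mul_nonneg hy.le (not_lt.1 hn)
      linarith
    nlinarith
  -- Parametrized by the return time, both `y₀ / a` and, by reversal, `-y₁ / a` increase.
  · rcases lt_trichotomy τ σ with hc | hc | hc
    · have k1 := h.quotient_lt hy h' hu hu' ha hc
      have k2 := h.reverse.quotient_lt (by linarith) h'.reverse (by linarith)
        (by linarith) ha hc
      rcases ha.lt_or_gt with ha | ha
      · rw [div_lt_div_right_of_neg ha] at k1; linarith
      · rw [div_lt_div_iff_of_pos_right ha] at k2; linarith
    · subst hc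
      have hS := h.flowS_ne_zero hy hy' ha
      have := mul_right_cancel₀ hS (h.rel.trans h'.rel.symm)
      linarith
    · have k1 := h'.quotient_lt hu h hy hy' ha hc
      have k2 := h'.reverse.quotient_lt (by linarith) h.reverse (by linarith)
        (by linarith) ha hc
      rcases ha.lt_or_gt with ha | ha
      · rw [div_lt_div_right_of_neg ha] at k2; linarith
      · rw [div_lt_div_iff_of_pos_right ha] at k1; linarith

/-- With zero trace the half-map is `y ↦ -y`. -/
theorem eq_neg_of_trace_zero (h : Ret 0 D a y₀ y₁ τ) (hy : 0 < y₀) (hy' : y₁ < 0) :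
    y₁ = -y₀ := by
  -- With zero trace the reversed return belongs to the same system and has the same duration, so
  -- its closing relation has the same coefficients.
  have h1 := h.reverse
  rw [neg_zero] at h1
  rcases eq_or_ne a 0 with rfl | ha
  · have hw := flow_wronskian 0 D τ
    have hS : flowS 0 D τ = 0 := by
      have := h.rel
      rw [zero_mul] at this
      exact (mul_eq_zero.1 this).resolve_left hy.ne'
    have d := h.deriv_end
    rw [flowX', zero_mul, zero_sub] at d
    rw [hS] at hw
    simp at hw
    rcases hw with hw | hw <;> rw [hw] at d <;> linarith
  · have hS := h.flowS_ne_zero hy hy' ha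
    have := mul_right_cancel₀ hS (h.rel.trans h1.rel.symm)
    linarith

end Ret

/-! ### Normalized closing relations and rigidity. -/

namespace Ret

variable {T D a y₀ y₁ τ : ℝ}

/-- Eliminating `flowP` with `mul_flowP` and removing the factor `e^{T τ / 2}` leaves only the
scale-invariant quantities `T τ`, `D τ²`, `a τ`. For `D = 0` the relation is trivial, and
`rel_of_det_zero` replaces it. -/
theorem normalized_rel (h : Ret T D a y₀ y₁ τ) :
    y₀ * sinq ((D - T ^ 2 / 4) * τ ^ 2) * (D * τ ^ 2) =
      a * τ * (Real.exp (-(T / 2 * τ)) + T / 2 * τ * sinq ((D - T ^ 2 / 4) * τ ^ 2)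
        - cosq ((D - T ^ 2 / 4) * τ ^ 2)) := by
  have h1 := h.rel
  have h2 := mul_flowP T D τ
  rw [flowS'_eq] at h2
  rw [flowS_eq] at h1 h2
  have he : Real.exp (-(T / 2 * τ)) * Real.exp (T / 2 * τ) = 1 := by
    rw [← Real.exp_add]; simp
  have hne := (Real.exp_pos (T / 2 * τ)).ne'
  refine mul_right_cancel₀ hne ?_
  linear_combination D * τ * h1 + a * τ * h2 - a * τ * he

theorem normalized_rel' (h : Ret T D a y₀ y₁ τ) :
    -y₁ * sinq ((D - T ^ 2 / 4) * τ ^ 2) * (D * τ ^ 2) =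
      a * τ * (Real.exp (T / 2 * τ) - T / 2 * τ * sinq ((D - T ^ 2 / 4) * τ ^ 2)
        - cosq ((D - T ^ 2 / 4) * τ ^ 2)) := by
  have h1 := h.reverse.normalized_rel
  rw [neg_sq, show -(-T / 2 * τ) = T / 2 * τ by ring] at h1
  linear_combination h1

theorem normalized_sum (h : Ret T D a y₀ y₁ τ) :
    (y₀ - y₁) * sinq ((D - T ^ 2 / 4) * τ ^ 2) * (D * τ ^ 2) =
      2 * (a * τ) * (Real.cosh (T / 2 * τ) - cosq ((D - T ^ 2 / 4) * τ ^ 2)) := by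
  have h1 := h.normalized_rel
  have h2 := h.normalized_rel'
  rw [Real.cosh_eq]
  linear_combination h1 + h2

theorem normalized_diff (h : Ret T D a y₀ y₁ τ) :
    (-y₁ - y₀) * sinq ((D - T ^ 2 / 4) * τ ^ 2) * (D * τ ^ 2) =
      2 * (a * τ) * (Real.sinh (T / 2 * τ) -
        T / 2 * τ * sinq ((D - T ^ 2 / 4) * τ ^ 2)) := by
  have h1 := h.normalized_rel
  have h2 := h.normalized_rel'
  rw [Real.sinh_eq]
  linear_combination h2 - h1

theorem rel_of_det_zero (h : Ret T 0 a y₀ y₁ τ) :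
    2 * (T / 2 * τ) * sinq (-(T / 2 * τ) ^ 2) * y₀ =
      a * τ * (sinq (-(T / 2 * τ) ^ 2) - Real.exp (-(T / 2 * τ))) := by
  have h1 := h.rel
  have h2 := mul_flowP_of_det_zero T τ
  rw [flowS_eq, show (0 - T ^ 2 / 4) * τ ^ 2 = -(T / 2 * τ) ^ 2 by ring] at h1 h2
  have he : Real.exp (-(T / 2 * τ)) * Real.exp (T / 2 * τ) = 1 := by
    rw [← Real.exp_add]; simp
  have hne := (Real.exp_pos (T / 2 * τ)).ne'
  refine mul_right_cancel₀ hne ?_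
  linear_combination T * h1 + a * h2 + a * τ * he

theorem rel_of_det_zero' (h : Ret T 0 a y₀ y₁ τ) :
    2 * (T / 2 * τ) * sinq (-(T / 2 * τ) ^ 2) * -y₁ =
      a * τ * (Real.exp (T / 2 * τ) - sinq (-(T / 2 * τ) ^ 2)) := by
  have h1 := h.reverse.rel_of_det_zero
  rw [show -(-T / 2 * τ) = T / 2 * τ by ring, show (-T / 2 * τ) ^ 2 = (T / 2 * τ) ^ 2 by ring] at h1
  linear_combination -h1

theorem sum_of_det_zero (h : Ret T 0 a y₀ y₁ τ) (hT : T ≠ 0) : y₀ - y₁ = a * τ := by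
  have h1 := h.rel_of_det_zero
  have h2 := h.rel_of_det_zero'
  have h3 := mul_sinq_neg_sq (T / 2 * τ)
  have hh : T / 2 * τ ≠ 0 := mul_ne_zero (by simpa using hT) h.pos.ne'
  have h4 : T / 2 * τ * sinq (-(T / 2 * τ) ^ 2) ≠ 0 := by
    rw [h3]; simpa using hh
  rw [Real.sinh_eq] at h3
  refine mul_left_cancel₀ h4 ?_
  linear_combination (h1 + h2) / 2 - a * τ * h3

theorem secantAt (h : Ret T D a y₀ y₁ τ) (hy : 0 < y₀) (hy' : y₁ < 0) (hT : T ≠ 0) {m : ℝ}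
    (hm : T / 2 * τ * m * (y₀ - y₁) = -y₁ - y₀) :
    SecantAt m (-(T / 2 * τ) ^ 2) ((D - T ^ 2 / 4) * τ ^ 2) := by
  have hh : T / 2 * τ ≠ 0 := mul_ne_zero (by simpa using hT) h.pos.ne'
  have hs0 := mul_sinq_neg_sq (T / 2 * τ)
  constructor
  · rw [cosq_neg_sq]
    refine mul_left_cancel₀ hh ?_
    rw [mul_sub _ (sinq (-(T / 2 * τ) ^ 2)), hs0]
    rcases eq_or_ne a 0 with rfl | ha
    · have hz := h.sq_eq_of_zero hy
      have hd := h.deriv_end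
      rw [flowX', zero_mul, zero_sub, flowS'_eq, hz, sinq_pi_sq, cosq_pi_sq] at hd
      have he : Real.exp (-(T / 2 * τ)) * Real.exp (T / 2 * τ) = 1 := by
        rw [← Real.exp_add]; simp
      have hy1 : y₁ = -y₀ * Real.exp (T / 2 * τ) := by linear_combination hd
      rw [hz, sinq_pi_sq, cosq_pi_sq, Real.sinh_eq, Real.cosh_eq]
      rw [hy1] at hm
      have hm2 : T / 2 * τ * m * (1 + Real.exp (T / 2 * τ)) = Real.exp (T / 2 * τ) - 1 := by
        refine mul_left_cancel₀ hy.ne' ?_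
        linear_combination hm
      have hpos : 1 + Real.exp (T / 2 * τ) ≠ 0 := by positivity
      refine mul_right_cancel₀ hpos ?_
      linear_combination (1 + (Real.exp (T / 2 * τ) + Real.exp (-(T / 2 * τ))) / 2) * hm2 + he
    · have h1 := h.normalized_sum
      have h2 := h.normalized_diff
      have ha' : 2 * (a * τ) ≠ 0 := mul_ne_zero two_ne_zero (mul_ne_zero ha h.pos.ne')
      refine mul_left_cancel₀ ha' ?_
      linear_combination -(T / 2 * τ * m) * h1 + h2 +
        sinq ((D - T ^ 2 / 4) * τ ^ 2) * (D * τ ^ 2) * hm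
  -- The second intersection merges with the first exactly when `D = 0`; the determinant-zero
  -- relations then supply tangency.
  · intro hz
    have hD : D = 0 := by
      have h1 : D * τ ^ 2 = 0 := by linear_combination hz
      exact (mul_eq_zero.1 h1).resolve_right (pow_ne_zero 2 h.pos.ne')
    subst hD
    have h1 := h.rel_of_det_zero
    have h2 := h.rel_of_det_zero'
    have h3 := h.sum_of_det_zero hT
    have hp := mul_pq (-(T / 2 * τ) ^ 2)
    rw [cosq_neg_sq, Real.cosh_eq] at hp
    have ha : a * τ ≠ 0 := by rw [← h3]; linarith
    have hh2 : (T / 2 * τ) ^ 2 ≠ 0 := pow_ne_zero 2 hh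
    refine mul_left_cancel₀ hh2 (mul_left_cancel₀ ha ?_)
    rw [← h3] at h1 h2 ⊢
    linear_combination T / 2 * τ * sinq (-(T / 2 * τ) ^ 2) * hm + (h2 - h1) / 2 + (y₀ - y₁) * hp

/-- Two return maps with a common pair of endpoints and the same nonzero divergence integral come
from the same linear system, up to a change of time scale. -/
theorem parameters_eq {T' D' a' σ : ℝ} (h : Ret T D a y₀ y₁ τ) (h' : Ret T' D' a' y₀ y₁ σ)
    (hy : 0 < y₀) (hy' : y₁ < 0) (hT : T ≠ 0) (he : T * τ = T' * σ) :
    D * τ ^ 2 = D' * σ ^ 2 ∧ a * τ = a' * σ := by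
  have hT' : T' ≠ 0 := by
    rintro rfl
    rw [zero_mul] at he
    exact mul_ne_zero hT h.pos.ne' he
  have hh : T / 2 * τ ≠ 0 := mul_ne_zero (by simpa using hT) h.pos.ne'
  have heh : T / 2 * τ = T' / 2 * σ := by linear_combination he / 2
  have hsum : 0 < y₀ - y₁ := by linarith
  -- The slope common to both systems: `h m` is the ratio of `-y₁ - y₀` to `y₀ - y₁`, of modulus
  -- less than `1` because `y₁ < 0 < y₀`.
  set m : ℝ := (-y₁ - y₀) / (T / 2 * τ * (y₀ - y₁)) with hmdef
  have hm : T / 2 * τ * m * (y₀ - y₁) = -y₁ - y₀ := by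
    rw [hmdef]; field_simp [h.pos.ne', hsum.ne']
  have hmabs : |T / 2 * τ * m| < 1 := by
    have : T / 2 * τ * m = (-y₁ - y₀) / (y₀ - y₁) := by
      rw [eq_div_iff hsum.ne', hm]
    rw [this, abs_lt, lt_div_iff₀ hsum, div_lt_iff₀ hsum]
    constructor <;> linarith
  have k1 := h.secantAt hy hy' hT hm
  have k2 := h'.secantAt hy hy' hT' (m := m) (by rw [← heh]; exact hm)
  rw [← heh] at k2
  have hz := SecantAt.param_eq hh hmabs (h.sq_lt hy hy') (h'.sq_lt hy hy') k1 k2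
  have hD : D * τ ^ 2 = D' * σ ^ 2 := by
    linear_combination hz + (T / 2 * τ + T' / 2 * σ) * heh
  refine ⟨hD, ?_⟩
  -- `normalized_sum` determines `a τ` unless its right-hand factor vanishes. Since `cosh h > 1`,
  -- vanishing forces `z = -h²`, that is `D = 0`, and then `a τ = y₀ - y₁`.
  rcases eq_or_ne (cosq ((D - T ^ 2 / 4) * τ ^ 2)) (Real.cosh (T / 2 * τ)) with hc | hc
  · have hgt : 1 < Real.cosh (T / 2 * τ) := Real.one_lt_cosh.2 hh
    have hneg : (D - T ^ 2 / 4) * τ ^ 2 < 0 := by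
      by_contra hn
      have := cosq_le_one_of_nonneg (not_lt.1 hn)
      linarith
    have hpi : 0 < Real.pi ^ 2 := by positivity
    rw [← cosq_neg_sq] at hc
    have hzz := strictAntiOn_cosq.injOn (mem_Iic.2 (hneg.le.trans hpi.le))
      (mem_Iic.2 (by nlinarith [sq_nonneg (T / 2 * τ)])) hc
    have hD0 : D * τ ^ 2 = 0 := by linear_combination hzz
    have h1 : D = 0 := (mul_eq_zero.1 hD0).resolve_right (pow_ne_zero 2 h.pos.ne')
    have h2 : D' = 0 :=
      (mul_eq_zero.1 (hD.symm.trans hD0)).resolve_right (pow_ne_zero 2 h'.pos.ne')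
    subst h1 h2
    rw [← h.sum_of_det_zero hT, h'.sum_of_det_zero hT']
  · have s1 := h.normalized_sum
    have s2 := h'.normalized_sum
    rw [← heh, ← hz, ← hD, s1] at s2
    have := mul_right_cancel₀ (sub_ne_zero.2 hc.symm) s2
    linarith

end Ret

/-! ### Smooth dependence of the half-map on the starting point. -/

theorem continuous_flowX_prod (T D a : ℝ) : Continuous fun p : ℝ × ℝ => flowX T D a p.1 p.2 := by
  have := continuous_flowP T D
  have := continuous_flowS T D
  unfold flowX
  fun_prop

theorem continuous_flowX'_prod (T D a : ℝ) :
    Continuous fun p : ℝ × ℝ => flowX' T D a p.1 p.2 := by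
  have := continuous_flowS T D
  have := continuous_flowS' T D
  unfold flowX'
  fun_prop

theorem continuous_flowY_prod (T D a : ℝ) : Continuous fun p : ℝ × ℝ => flowY T D a p.1 p.2 :=
  ((continuous_flowX_prod T D a).const_mul T).sub (continuous_flowX'_prod T D a)

theorem hasStrictFDerivAt_flowX (T D a : ℝ) (p : ℝ × ℝ) :
    HasStrictFDerivAt (fun p : ℝ × ℝ => flowX T D a p.1 p.2)
      (flowX' T D a p.1 p.2 • ContinuousLinearMap.snd ℝ ℝ ℝ -
        flowS T D p.2 • ContinuousLinearMap.fst ℝ ℝ ℝ) p := by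
  have hP : HasStrictDerivAt (flowP T D) (flowS T D p.2) p.2 :=
    hasStrictDerivAt_of_hasDerivAt_of_continuousAt
      (Eventually.of_forall (hasDerivAt_flowP T D)) (continuous_flowS T D).continuousAt
  have hS : HasStrictDerivAt (flowS T D) (flowS' T D p.2) p.2 :=
    hasStrictDerivAt_of_hasDerivAt_of_continuousAt
      (Eventually.of_forall (hasDerivAt_flowS T D)) (continuous_flowS' T D).continuousAt
  have h1 := (hP.comp_hasStrictFDerivAt p (hasStrictFDerivAt_snd (𝕜 := ℝ))).const_mul a
  have h2 := (hasStrictFDerivAt_fst (𝕜 := ℝ) (p := p)).mul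
    (hS.comp_hasStrictFDerivAt p (hasStrictFDerivAt_snd (𝕜 := ℝ)))
  refine (h1.sub h2).congr_fderiv ?_
  ext <;> simp [flowX']

/-- The implicit function theorem for the zeros of the abscissa. -/
theorem exists_zero_time {T D a y₀ τ : ℝ} (h0 : flowX T D a y₀ τ = 0)
    (h1 : flowX' T D a y₀ τ ≠ 0) :
    ∃ θ : ℝ → ℝ, θ y₀ = τ ∧ DifferentiableAt ℝ θ y₀ ∧
      ∀ᶠ y in 𝓝 y₀, flowX T D a y (θ y) = 0 := by
  have hf := hasStrictFDerivAt_flowX T D a (y₀, τ)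
  have hinv : ((flowX' T D a y₀ τ • ContinuousLinearMap.snd ℝ ℝ ℝ -
      flowS T D τ • ContinuousLinearMap.fst ℝ ℝ ℝ) ∘L .inr ℝ ℝ ℝ).IsInvertible := by
    refine ⟨ContinuousLinearEquiv.unitsEquivAut ℝ (Units.mk0 _ h1), ?_⟩
    ext
    simp
  refine ⟨hf.implicitFunctionOfProdDomain hinv, ?_,
    (hf.hasStrictFDerivAt_implicitFunctionOfProdDomain hinv).differentiableAt, ?_⟩
  · exact (hf.eventually_apply_eq_iff_implicitFunctionOfProdDomain hinv).self_of_nhds.mp rfl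
  · filter_upwards [hf.eventually_apply_implicitFunctionOfProdDomain hinv] with y hy
    exact hy.trans h0

theorem exists_radius_of_eventually_prod {y₀ t₀ : ℝ} {p : ℝ × ℝ → Prop}
    (h : ∀ᶠ q in 𝓝 (y₀, t₀), p q) :
    ∃ ε > 0, ∀ᶠ y in 𝓝 y₀, ∀ t, |t - t₀| < ε → p (y, t) := by
  rw [nhds_prod_eq] at h
  obtain ⟨pa, ha, pb, hb, hab⟩ := eventually_prod_iff.1 h
  obtain ⟨ε, hε, hb⟩ := Metric.eventually_nhds_iff.1 hb
  exact ⟨ε, hε, ha.mono fun y hy t ht => hab hy (hb (by rwa [Real.dist_eq]))⟩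

namespace Ret

variable {T D a y₀ y₁ τ : ℝ}

/-- Ensures that the zero from the implicit function theorem is still the first return: nearby
abscissas decrease near time `0`, increase near `τ`, and stay negative in between by compactness. -/
theorem eventually_neg (h : Ret T D a y₀ y₁ τ) (hy : 0 < y₀) (hy' : y₁ < 0) :
    ∃ ε > 0, ε < τ ∧ ∀ᶠ y in 𝓝 y₀, ∀ s, |s - τ| < ε → flowX T D a y s = 0 →
      ∀ t ∈ Ioo 0 s, flowX T D a y t < 0 := by
  have hX' := continuous_flowX'_prod T D a
  have e1 : ∀ᶠ q in 𝓝 (y₀, (0 : ℝ)), flowX' T D a q.1 q.2 < 0 :=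
    hX'.continuousAt.eventually (gt_mem_nhds (by simpa [flowX'_zero] using hy))
  have e2 : ∀ᶠ q in 𝓝 (y₀, τ), 0 < flowX' T D a q.1 q.2 :=
    hX'.continuousAt.eventually (lt_mem_nhds (by simpa [h.deriv_end] using hy'))
  obtain ⟨r₁, hr₁, e1⟩ := exists_radius_of_eventually_prod e1
  obtain ⟨r₂, hr₂, e2⟩ := exists_radius_of_eventually_prod e2
  have hτ := h.pos
  set ε := min (min r₁ r₂) τ / 2 with hε
  have hm : 0 < min (min r₁ r₂) τ := lt_min (lt_min hr₁ hr₂) hτ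
  have hεpos : 0 < ε := half_pos hm
  have hε1 : ε < r₁ := by
    have := (min_le_left (min r₁ r₂) τ).trans (min_le_left _ _); linarith
  have hε2 : ε < r₂ := by
    have := (min_le_left (min r₁ r₂) τ).trans (min_le_right _ _); linarith
  have hετ : ε < τ := by
    have := min_le_right (min r₁ r₂) τ; linarith
  have e3 : ∀ᶠ y in 𝓝 y₀, ∀ t ∈ Icc ε (τ - ε), flowX T D a y t < 0 := by
    refine isCompact_Icc.eventually_forall_of_forall_eventually fun t ht => ?_
    exact (continuous_flowX_prod T D a).continuousAt.eventually
      (gt_mem_nhds (h.neg t ⟨by linarith [ht.1], by linarith [ht.2]⟩))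
  refine ⟨ε, hεpos, hετ, ?_⟩
  filter_upwards [e1, e2, e3] with y k1 k2 k3 s hs hs0 t ht
  rw [abs_lt] at hs
  rcases lt_or_ge t ε with hlt | hge
  · have hanti : StrictAntiOn (flowX T D a y) (Icc 0 t) := by
      refine strictAntiOn_of_deriv_neg (convex_Icc _ _)
        (fun u _ => (hasDerivAt_flowX T D a y u).continuousAt.continuousWithinAt) fun u hu => ?_
      rw [interior_Icc] at hu
      rw [(hasDerivAt_flowX T D a y u).deriv]
      exact k1 u (by rw [abs_lt]; constructor <;> linarith [hu.1, hu.2])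
    have := hanti (left_mem_Icc.2 ht.1.le) (right_mem_Icc.2 ht.1.le) ht.1
    rwa [flowX_zero] at this
  · rcases le_or_gt t (τ - ε) with hle | hgt
    · exact k3 t ⟨hge, hle⟩
    · have hmono : StrictMonoOn (flowX T D a y) (Icc t s) := by
        refine strictMonoOn_of_deriv_pos (convex_Icc _ _)
          (fun u _ => (hasDerivAt_flowX T D a y u).continuousAt.continuousWithinAt) fun u hu => ?_
        rw [interior_Icc] at hu
        rw [(hasDerivAt_flowX T D a y u).deriv]
        exact k2 u (by rw [abs_lt]; constructor <;> linarith [hu.1, hu.2])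
      have := hmono (left_mem_Icc.2 ht.2.le) (right_mem_Icc.2 ht.2.le) ht.2
      rwa [hs0] at this

/-- Near a transversal return the half-map is defined and differentiable. -/
theorem exists_local (h : Ret T D a y₀ y₁ τ) (hy : 0 < y₀) (hy' : y₁ < 0) :
    ∃ θ : ℝ → ℝ, θ y₀ = τ ∧ ContinuousAt θ y₀ ∧
      (∀ᶠ y in 𝓝 y₀, Ret T D a y (flowY T D a y (θ y)) (θ y)) ∧
      HasDerivAt (fun y => flowY T D a y (θ y)) (y₀ / y₁ * Real.exp (T * τ)) y₀ := by
  have hd := h.deriv_end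
  obtain ⟨θ, hθ0, hθd, hθ⟩ := exists_zero_time h.zero (by rw [hd]; linarith)
  have hθc := hθd.continuousAt
  refine ⟨θ, hθ0, hθc, ?_, ?_⟩
  · obtain ⟨ε, hε, hετ, hev⟩ := h.eventually_neg hy hy'
    have hnear : ∀ᶠ y in 𝓝 y₀, |θ y - τ| < ε := by
      have := hθc.eventually (Metric.ball_mem_nhds (θ y₀) hε)
      rw [hθ0] at this
      filter_upwards [this] with y hy
      rwa [Real.dist_eq] at hy
    filter_upwards [hθ, hev, hnear] with y k1 k2 k3
    refine ⟨?_, k1, rfl, k2 _ k3 k1⟩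
    rw [abs_lt] at k3
    linarith
  · obtain ⟨θ', hθ'⟩ : ∃ d, HasDerivAt θ d y₀ := ⟨_, hθd.hasDerivAt⟩
    have hP := (hasDerivAt_flowP T D (θ y₀)).comp y₀ hθ'
    have hS := (hasDerivAt_flowS T D (θ y₀)).comp y₀ hθ'
    have hS' := (hasDerivAt_flowS' T D (θ y₀)).comp y₀ hθ'
    have hX := (hP.const_mul a).sub ((hasDerivAt_id y₀).mul hS)
    have hX' := (hS.const_mul a).sub ((hasDerivAt_id y₀).mul hS')
    have hX0 : HasDerivAt (fun y => flowX T D a y (θ y)) 0 y₀ :=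
      (hasDerivAt_const y₀ (0 : ℝ)).congr_of_eventuallyEq hθ
    have k := hX.unique hX0
    refine ((hX0.const_mul T).sub hX').congr_deriv ?_
    simp only [hθ0, Function.comp, id] at k ⊢
    have hw := flow_wronskian T D τ
    rw [flowX'] at hd
    have hd' : y₁ = y₀ * flowS' T D τ - a * flowS T D τ := by linarith
    -- Derivative of `flowX T D a y (θ y) = 0`; inserting it in the derivative of the ordinate
    -- leaves the Wronskian `e^{T τ}`.
    have k' : θ' * y₁ = -flowS T D τ := by
      rw [hd']; linear_combination -k
    rw [div_mul_eq_mul_div, eq_div_iff hy'.ne]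
    linear_combination flowS' T D τ * hd' -
      (a * flowS' T D τ - y₀ * (T * flowS' T D τ - D * flowS T D τ)) * k' + y₀ * hw

end Ret

/-! ### Decomposition of a closed crossing orbit into arcs. -/

theorem eventually_neg_right_of_deriv_neg {f : ℝ → ℝ} {t₀ d : ℝ} (hd : HasDerivAt f d t₀)
    (hneg : d < 0) (h0 : f t₀ = 0) : ∃ η > 0, ∀ t ∈ Ioo t₀ (t₀ + η), f t < 0 := by
  have h := hd.tendsto_slope.eventually (gt_mem_nhds hneg)
  rw [eventually_nhdsWithin_iff] at h
  obtain ⟨η, hη, h⟩ := Metric.eventually_nhds_iff.1 h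
  refine ⟨η, hη, fun t ht => ?_⟩
  have hlt := h (y := t) (by rw [Real.dist_eq, abs_lt]; constructor <;> linarith [ht.1, ht.2])
    (by simpa using ht.1.ne')
  rw [slope_def_field, h0, sub_zero] at hlt
  have := ht.1
  rw [div_lt_iff₀ (by linarith), zero_mul] at hlt
  exact hlt

/-- The next zero after a zero with negative derivative. -/
theorem exists_next_zero {f : ℝ → ℝ} (hf : Continuous f) {t₀ s d : ℝ} (hd : HasDerivAt f d t₀)
    (hneg : d < 0) (h0 : f t₀ = 0) (hs : t₀ < s) (hfs : f s = 0) :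
    ∃ τ, t₀ < τ ∧ f τ = 0 ∧ ∀ t ∈ Ioo t₀ τ, f t < 0 := by
  obtain ⟨η, hη, hη'⟩ := eventually_neg_right_of_deriv_neg hd hneg h0
  have hsη : t₀ + η ≤ s := by
    by_contra hn
    exact absurd hfs (hη' s ⟨hs, not_le.1 hn⟩).ne
  have hK : IsCompact (Icc (t₀ + η) s ∩ f ⁻¹' {0}) :=
    isCompact_Icc.inter_right (isClosed_singleton.preimage hf)
  obtain ⟨τ, ⟨hτ1, hτ2⟩, hmin⟩ := hK.exists_isLeast ⟨s, ⟨hsη, le_rfl⟩, hfs⟩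
  refine ⟨τ, by linarith [hτ1.1], hτ2, fun t ht => ?_⟩
  rcases lt_or_ge t (t₀ + η) with hlt | hge
  · exact hη' t ⟨ht.1, hlt⟩
  · by_contra hn
    have hmid : f (t₀ + η / 2) < 0 := hη' _ ⟨by linarith, by linarith⟩
    obtain ⟨u, hu, hu0⟩ := intermediate_value_Icc (by linarith : t₀ + η / 2 ≤ t) hf.continuousOn
      ⟨hmid.le, not_lt.1 hn⟩
    rcases lt_or_ge u (t₀ + η) with h1 | h1
    · exact (hη' u ⟨by linarith [hu.1], h1⟩).ne hu0
    · have := hmin ⟨⟨h1, by linarith [hu.2, ht.2, hτ1.2]⟩, hu0⟩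
      linarith [hu.2, ht.2]

theorem deriv_nonneg_of_neg_left {f : ℝ → ℝ} {t₀ τ d : ℝ} (hd : HasDerivAt f d τ) (h0 : f τ = 0)
    (hτ : t₀ < τ) (hneg : ∀ t ∈ Ioo t₀ τ, f t < 0) : 0 ≤ d := by
  have h := hd.tendsto_slope.mono_left (nhdsWithin_mono τ (fun t ht => ne_of_lt ht) :
    𝓝[<] τ ≤ 𝓝[≠] τ)
  refine ge_of_tendsto h ?_
  filter_upwards [Ioo_mem_nhdsLT hτ] with t ht
  rw [slope_def_field, h0, sub_zero]
  exact div_nonneg_of_nonpos (hneg t ht).le (by linarith [ht.2])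

namespace LienardPWL

/-- The system obtained by time reversal and reflection in the switching line. -/
def swap (S : LienardPWL) : LienardPWL := ⟨-S.TR, S.DR, -S.aR, -S.TL, S.DL, -S.aL⟩

namespace IsCrossingSolution

variable {S : LienardPWL} {x y : ℝ → ℝ}

theorem swap (h : S.IsCrossingSolution x y) :
    S.swap.IsCrossingSolution (fun t => -x (-t)) (fun t => y (-t)) where
  continuous_y := h.continuous_y.comp continuous_neg
  left t ht := by
    obtain ⟨h1, h2⟩ := h.right (-t) (by simpa using ht)
    have h1 := (h1.scomp t (hasDerivAt_neg t)).neg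
    have h2 := h2.scomp t (hasDerivAt_neg t)
    exact ⟨h1.congr_deriv (by simp [LienardPWL.swap]),
      h2.congr_deriv (by simp [LienardPWL.swap]; ring)⟩
  right t ht := by
    obtain ⟨h1, h2⟩ := h.left (-t) (by simpa using ht)
    have h1 := (h1.scomp t (hasDerivAt_neg t)).neg
    have h2 := h2.scomp t (hasDerivAt_neg t)
    exact ⟨h1.congr_deriv (by simp [LienardPWL.swap]),
      h2.congr_deriv (by simp [LienardPWL.swap]; ring)⟩
  crossing t ht := by
    obtain ⟨h0, h1⟩ := h.crossing (-t) (by simpa using ht)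
    have h1 := (h1.scomp t (hasDerivAt_neg t)).neg
    exact ⟨h0, h1.congr_deriv (by simp)⟩

theorem continuous_x (h : S.IsCrossingSolution x y) : Continuous x := by
  refine continuous_iff_continuousAt.2 fun t => ?_
  rcases lt_trichotomy (x t) 0 with ht | ht | ht
  · exact (h.left t ht).1.continuousAt
  · exact (h.crossing t ht).2.continuousAt
  · exact (h.right t ht).1.continuousAt

/-- An arc of a crossing solution in `x < 0` is an arc of the left linear flow. -/
theorem ret_of_neg (h : S.IsCrossingSolution x y) {t₀ τ : ℝ} (hlt : t₀ < τ) (h0 : x t₀ = 0)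
    (h1 : x τ = 0) (hneg : ∀ t ∈ Ioo t₀ τ, x t < 0) :
    Ret S.TL S.DL S.aL (y t₀) (y τ) (τ - t₀) ∧ ∀ u ∈ Icc 0 (τ - t₀),
      x (t₀ + u) = flowX S.TL S.DL S.aL (y t₀) u ∧ y (t₀ + u) = flowY S.TL S.DL S.aL (y t₀) u := by
  have hcx := h.continuous_x
  have hcy := h.continuous_y
  -- The equation for `y` is assumed only off the switching line; its right derivative at the
  -- crossing is the limit of the derivatives along the arc.
  have hyd : HasDerivWithinAt y (S.DL * x t₀ - S.aL) (Ici t₀) t₀ := by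
    have hd : ∀ t ∈ Ioo t₀ τ, HasDerivAt y (S.DL * x t - S.aL) t := fun t ht =>
      (h.left t (hneg t ht)).2
    refine hasDerivWithinAt_Ici_of_tendsto_deriv (s := Ioo t₀ τ)
      (fun t ht => (hd t ht).differentiableAt.differentiableWithinAt)
      hcy.continuousAt.continuousWithinAt (Ioo_mem_nhdsGT hlt) ?_
    have hc : Tendsto (fun t => S.DL * x t - S.aL) (𝓝[>] t₀) (𝓝 (S.DL * x t₀ - S.aL)) :=
      ((hcx.const_mul S.DL).sub continuous_const).continuousAt.continuousWithinAt
    refine hc.congr' ?_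
    filter_upwards [Ioo_mem_nhdsGT hlt] with t ht
    exact (hd t ht).deriv.symm
  have hshift : ∀ u, HasDerivAt (fun u => t₀ + u) 1 u := fun u => (hasDerivAt_id u).const_add t₀
  have key := eqOn_flow (T := S.TL) (D := S.DL) (a := S.aL) (y := y t₀) (τ := τ - t₀)
    (x' := fun u => x (t₀ + u)) (y' := fun u => y (t₀ + u))
    (hcx.comp (by fun_prop)).continuousOn (hcy.comp (by fun_prop)).continuousOn ?_
    (by simpa using h0) (by simp)
  · refine ⟨⟨by linarith, ?_, ?_, fun t ht => ?_⟩, key⟩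
    · rw [← (key (τ - t₀) ⟨by linarith, le_rfl⟩).1]; simpa using h1
    · rw [← (key (τ - t₀) ⟨by linarith, le_rfl⟩).2]; simp
    · rw [← (key t ⟨ht.1.le, ht.2.le⟩).1]
      exact hneg _ ⟨by linarith [ht.1], by linarith [ht.2]⟩
  · intro u hu
    rcases hu.1.eq_or_lt with rfl | hu0
    · constructor
      · have h2 := (h.crossing t₀ h0).2
        have h3 : HasDerivAt (fun u => x (t₀ + u)) (-(y t₀) * 1) 0 := by
          refine HasDerivAt.comp (h₂ := x) 0 ?_ (hshift 0)
          simpa using h2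
        refine (h3.congr_deriv ?_).hasDerivWithinAt
        simp [h0]
      · have h3 : HasDerivWithinAt (fun u => y (t₀ + u)) ((S.DL * x t₀ - S.aL) * 1) (Ici 0) 0 := by
          refine HasDerivWithinAt.comp (h₂ := y) (s' := Ici t₀) 0 ?_ (hshift 0).hasDerivWithinAt ?_
          · simpa using hyd
          · intro v hv; simpa using hv
        simpa using h3
    · obtain ⟨h2, h3⟩ := h.left (t₀ + u) (hneg _ ⟨by linarith, by linarith [hu.2]⟩)
      constructor
      · have := h2.comp u (hshift u)
        rw [mul_one] at this
        exact this.hasDerivWithinAt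
      · have := h3.comp u (hshift u)
        rw [mul_one] at this
        exact this.hasDerivWithinAt

theorem exists_left_arc (h : S.IsCrossingSolution x y) {P t₀ : ℝ} (hP : 0 < P)
    (hxP : Function.Periodic x P) (h0 : x t₀ = 0) (hy : 0 < y t₀) :
    ∃ τ, t₀ < τ ∧ x τ = 0 ∧ y τ < 0 ∧ ∀ t ∈ Ioo t₀ τ, x t < 0 := by
  obtain ⟨τ, hτ, hxτ, hneg⟩ := exists_next_zero h.continuous_x (h.crossing t₀ h0).2
    (by linarith) h0 (lt_add_of_pos_right t₀ hP) (by rw [hxP, h0])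
  obtain ⟨hne, hd⟩ := h.crossing τ hxτ
  have := deriv_nonneg_of_neg_left hd hxτ hτ hneg
  exact ⟨τ, hτ, hxτ, lt_of_le_of_ne (by linarith) hne, hneg⟩

theorem exists_right_arc (h : S.IsCrossingSolution x y) {P t₀ : ℝ} (hP : 0 < P)
    (hxP : Function.Periodic x P) (h0 : x t₀ = 0) (hy : y t₀ < 0) :
    ∃ τ, t₀ < τ ∧ x τ = 0 ∧ 0 < y τ ∧ ∀ t ∈ Ioo t₀ τ, 0 < x t := by
  obtain ⟨τ, hτ, hxτ, hneg⟩ := exists_next_zero (f := fun t => -x t) h.continuous_x.neg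
    (h.crossing t₀ h0).2.neg (by linarith) (by simp [h0]) (lt_add_of_pos_right t₀ hP)
    (by simp [hxP t₀, h0])
  have hxτ : x τ = 0 := by simpa using hxτ
  obtain ⟨hne, hd⟩ := h.crossing τ hxτ
  have := deriv_nonneg_of_neg_left (f := fun t => -x t) hd.neg (by simp [hxτ]) hτ hneg
  exact ⟨τ, hτ, hxτ, lt_of_le_of_ne (by linarith) hne.symm, fun t ht => by
    have := hneg t ht; linarith⟩

/-- Two consecutive arcs of a periodic crossing solution. -/
theorem exists_two_arcs (h : S.IsCrossingSolution x y) {P t₀ : ℝ} (hP : 0 < P)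
    (hxP : Function.Periodic x P) (h0 : x t₀ = 0) (hy : 0 < y t₀) :
    ∃ y₁ < 0, ∃ τ, Ret S.TL S.DL S.aL (y t₀) y₁ τ ∧
      (∀ u ∈ Icc 0 τ, x (t₀ + u) = flowX S.TL S.DL S.aL (y t₀) u ∧
        y (t₀ + u) = flowY S.TL S.DL S.aL (y t₀) u) ∧
      ∃ t₂, x t₂ = 0 ∧ 0 < y t₂ ∧ ∃ σ, Ret (-S.TR) S.DR (-S.aR) (y t₂) y₁ σ := by
  obtain ⟨t₁, ht₁, hx₁, hy₁, hneg⟩ := h.exists_left_arc hP hxP h0 hy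
  obtain ⟨hr, harc⟩ := h.ret_of_neg ht₁ h0 hx₁ hneg
  obtain ⟨t₂, ht₂, hx₂, hy₂, hpos⟩ := h.exists_right_arc hP hxP hx₁ hy₁
  obtain ⟨hr', -⟩ := h.swap.ret_of_neg (t₀ := -t₂) (τ := -t₁) (by linarith) (by simp [hx₂])
    (by simp [hx₁]) fun t ht => by
      have := hpos (-t) ⟨by linarith [ht.2], by linarith [ht.1]⟩
      linarith
  simp only [neg_neg] at hr'
  exact ⟨y t₁, hy₁, t₁ - t₀, hr, harc, t₂, hx₂, hy₂, _, hr'⟩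

end IsCrossingSolution

/-- A closed crossing orbit consists of one left arc and one right arc with common endpoints. -/
theorem IsCrossingClosedOrbit.exists_arcs {S : LienardPWL} {Γ : Set (ℝ × ℝ)}
    (hΓ : S.IsCrossingClosedOrbit Γ) :
    ∃ y₀ y₁ τ σ : ℝ, 0 < y₀ ∧ y₁ < 0 ∧ Ret S.TL S.DL S.aL y₀ y₁ τ ∧
      Ret (-S.TR) S.DR (-S.aR) y₀ y₁ σ ∧
      (∀ u ∈ Icc 0 τ, (flowX S.TL S.DL S.aL y₀ u, flowY S.TL S.DL S.aL y₀ u) ∈ Γ) ∧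
      (∀ u ∈ Icc 0 σ, (-flowX (-S.TR) S.DR (-S.aR) y₀ u,
        flowY (-S.TR) S.DR (-S.aR) y₀ u) ∈ Γ) ∧
      ∀ v > y₀, ((0 : ℝ), v) ∉ Γ := by
  obtain ⟨x, y, h, ⟨P, hP, hxP, hyP⟩, ⟨s, hs⟩, rfl⟩ := hΓ
  have hper : Function.Periodic (fun t => (x t, y t)) P := fun t => by
    simp only [hxP t, hyP t]
  obtain ⟨s', hs', hys'⟩ : ∃ s', x s' = 0 ∧ 0 < y s' := by
    rcases (h.crossing s hs).1.lt_or_gt with hlt | hgt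
    · obtain ⟨τ, -, h1, h2, -⟩ := h.exists_right_arc hP hxP hs hlt
      exact ⟨τ, h1, h2⟩
    · exact ⟨s, hs, hgt⟩
  have hK : IsCompact (Icc 0 P ∩ {t | x t = 0 ∧ 0 ≤ y t}) :=
    isCompact_Icc.inter_right ((isClosed_eq h.continuous_x continuous_const).inter
      (isClosed_le continuous_const h.continuous_y))
  have hmem : ∀ t, x t = 0 → 0 ≤ y t → ∃ u ∈ Icc 0 P ∩ {t | x t = 0 ∧ 0 ≤ y t}, y u = y t := by
    intro t ht hyt
    obtain ⟨u, hu, he⟩ := hper.exists_mem_Ico₀ hP t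
    simp only [Prod.mk.injEq] at he
    exact ⟨u, ⟨⟨hu.1, hu.2.le⟩, he.1 ▸ ht, he.2 ▸ hyt⟩, he.2.symm⟩
  obtain ⟨u', hu', -⟩ := hmem s' hs' hys'.le
  -- The highest crossing point is taken as the starting point.
  obtain ⟨t₀, ⟨-, ht₀, -⟩, hmax⟩ := hK.exists_isMaxOn ⟨u', hu'⟩ h.continuous_y.continuousOn
  have hle : ∀ t, x t = 0 → y t ≤ y t₀ := by
    intro t ht
    rcases le_or_gt 0 (y t) with hyt | hyt
    · obtain ⟨u, hu, he⟩ := hmem t ht hyt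
      rw [← he]; exact hmax hu
    · obtain ⟨u, hu, he⟩ := hmem s' hs' hys'.le
      have : y s' ≤ y t₀ := by rw [← he]; exact hmax hu
      linarith
  have hy₀ : 0 < y t₀ := hys'.trans_le (hle s' hs')
  obtain ⟨y₁, hy₁, τ, hL, harcL, t₂, hx₂, hy₂, σ₂, hR₂⟩ := h.exists_two_arcs hP hxP ht₀ hy₀
  have hxP' : Function.Periodic (fun t => -x (-t)) P := fun t => by
    have := hxP (-(t + P))
    simp only [neg_inj]
    rw [← this]; congr 1; ring
  obtain ⟨v₁, hv₁, σ, hR, harcR, r₂, hxr, hyr, σ₃, hL₂⟩ :=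
    h.swap.exists_two_arcs (t₀ := -t₀) hP hxP' (by simp [ht₀]) (by simpa using hy₀)
  simp only [swap, neg_neg] at hR harcR hL₂ hyr hxr
  -- Each half-map reaches the other's endpoint from a crossing at most as high as `y t₀`: the left
  -- map sends such a point to `v₁`, the right map sends one to `y₁`. As both are decreasing, `y₁ =
  -- v₁`, and the two arcs from the top close up.
  have e1 : y₁ ≤ v₁ := by
    rcases (hle (-r₂) (by simpa using hxr)).eq_or_lt with he | hlt
    · rw [he] at hL₂; exact (hL.unique hL₂).le
    · exact (hL₂.strictAnti hyr hv₁ hL hy₀ hy₁ hlt).le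
  have e2 : v₁ ≤ y₁ := by
    rcases (hle t₂ hx₂).eq_or_lt with he | hlt
    · rw [he] at hR₂; exact (hR.unique hR₂).le
    · exact (hR₂.strictAnti hy₂ hy₁ hR hy₀ hv₁ hlt).le
  obtain rfl := le_antisymm e1 e2
  refine ⟨y t₀, y₁, τ, σ, hy₀, hy₁, hL, hR, fun u hu => ⟨t₀ + u, ?_⟩,
    fun u hu => ⟨-(-t₀ + u), ?_⟩, ?_⟩
  · simp only [(harcL u hu).1, (harcL u hu).2]
  · simp only [← (harcR u hu).1, ← (harcR u hu).2, neg_neg]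
  · rintro v hv ⟨t, ht⟩
    simp only [Prod.mk.injEq] at ht
    have := hle t ht.1
    rw [ht.2] at this
    linarith

end LienardPWL

/-! ### Gluing two arcs into a periodic solution. -/

theorem hasDerivAt_of_sides {f g₁ g₂ : ℝ → ℝ} {a t b d : ℝ} (ha : a < t) (hb : t < b)
    (h1 : ∀ s ∈ Icc a t, f s = g₁ s) (h2 : ∀ s ∈ Icc t b, f s = g₂ s)
    (d1 : HasDerivAt g₁ d t) (d2 : HasDerivAt g₂ d t) : HasDerivAt f d t := by
  have k1 : HasDerivWithinAt f d (Iic t) t :=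
    ((d1.hasDerivWithinAt (s := Icc a t)).congr h1 (h1 t ⟨ha.le, le_rfl⟩)).mono_of_mem_nhdsWithin
      (Icc_mem_nhdsLE ha)
  have k2 : HasDerivWithinAt f d (Ici t) t :=
    ((d2.hasDerivWithinAt (s := Icc t b)).congr h2 (h2 t ⟨le_rfl, hb.le⟩)).mono_of_mem_nhdsWithin
      (Icc_mem_nhdsGE hb)
  simpa using k1.union k2

theorem continuousAt_of_sides {f g₁ g₂ : ℝ → ℝ} {a t b : ℝ} (ha : a < t) (hb : t < b)
    (h1 : ∀ s ∈ Icc a t, f s = g₁ s) (h2 : ∀ s ∈ Icc t b, f s = g₂ s)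
    (d1 : ContinuousAt g₁ t) (d2 : ContinuousAt g₂ t) : ContinuousAt f t := by
  refine continuousAt_iff_continuous_left_right.2 ⟨?_, ?_⟩
  · exact ((d1.continuousWithinAt (s := Icc a t)).congr h1
      (h1 t ⟨ha.le, le_rfl⟩)).mono_of_mem_nhdsWithin (Icc_mem_nhdsLE ha)
  · exact ((d2.continuousWithinAt (s := Icc t b)).congr h2
      (h2 t ⟨le_rfl, hb.le⟩)).mono_of_mem_nhdsWithin (Icc_mem_nhdsGE hb)

theorem Function.Periodic.hasDerivAt {f : ℝ → ℝ} {P d t : ℝ} (hf : Function.Periodic f P) (n : ℤ)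
    (h : HasDerivAt f d (t - n • P)) : HasDerivAt f d t := by
  have := h.comp_sub_const t (n • P)
  refine this.congr_of_eventuallyEq (Eventually.of_forall fun s => ?_)
  exact (hf.sub_zsmul_eq n).symm

theorem Function.Periodic.continuousAt {f : ℝ → ℝ} {P t : ℝ} (hf : Function.Periodic f P) (n : ℤ)
    (h : ContinuousAt f (t - n • P)) : ContinuousAt f t := by
  have : ContinuousAt (fun s => f (s - n • P)) t :=
    ContinuousAt.comp (g := f) h (continuousAt_id.sub continuousAt_const)
  refine this.congr (Eventually.of_forall fun s => ?_)
  exact hf.sub_zsmul_eq n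

/-- The function of period `σ + τ` which equals `g` on `[-σ, 0)` and `f` on `[0, τ)`. -/
noncomputable def periodicGlue {σ τ : ℝ} (hP : 0 < σ + τ) (g f : ℝ → ℝ) (t : ℝ) : ℝ :=
  if toIcoMod hP (-σ) t < 0 then g (toIcoMod hP (-σ) t) else f (toIcoMod hP (-σ) t)

theorem periodicGlue_periodic {σ τ : ℝ} (hP : 0 < σ + τ) (g f : ℝ → ℝ) :
    Function.Periodic (periodicGlue hP g f) (σ + τ) := fun t => by
  simp only [periodicGlue, toIcoMod_add_right]

theorem periodicGlue_right {σ τ : ℝ} (hP : 0 < σ + τ) (hτ : 0 < τ) {g f : ℝ → ℝ}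
    (h0 : g 0 = f 0) {t : ℝ} (ht : t ∈ Icc (-σ) 0) : periodicGlue hP g f t = g t := by
  have h : toIcoMod hP (-σ) t = t :=
    (toIcoMod_eq_self hP).2 ⟨ht.1, by linarith [ht.2]⟩
  rw [periodicGlue, h]
  rcases ht.2.eq_or_lt with rfl | hlt
  · simp [h0]
  · simp [hlt]

theorem periodicGlue_left {σ τ : ℝ} (hP : 0 < σ + τ) (hσ : 0 < σ) {g f : ℝ → ℝ}
    (h1 : g (-σ) = f τ) {t : ℝ} (ht : t ∈ Icc 0 τ) : periodicGlue hP g f t = f t := by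
  rcases ht.2.eq_or_lt with rfl | hlt
  · have h : toIcoMod hP (-σ) t = -σ := by
      have := toIcoMod_add_right hP (-σ) (-σ)
      rw [show -σ + (σ + t) = t by ring] at this
      rw [this]
      exact (toIcoMod_eq_self hP).2 ⟨le_rfl, by linarith⟩
    rw [periodicGlue, h, if_pos (by linarith), h1]
  · have h : toIcoMod hP (-σ) t = t :=
      (toIcoMod_eq_self hP).2 ⟨by linarith [ht.1], by linarith [ht.2]⟩
    rw [periodicGlue, h, if_neg (not_lt.2 ht.1)]

theorem periodicGlue_left_shift {σ τ : ℝ} (hP : 0 < σ + τ) (hσ : 0 < σ) {g f : ℝ → ℝ}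
    (h1 : g (-σ) = f τ) {t : ℝ} (ht : t ∈ Icc (-σ - τ) (-σ)) :
    periodicGlue hP g f t = f (t + (σ + τ)) := by
  rw [← periodicGlue_periodic hP g f t]
  exact periodicGlue_left hP hσ h1 ⟨by linarith [ht.1], by linarith [ht.2]⟩

namespace LienardPWL

/-- Gluing a left arc and a right arc with common endpoints. -/
theorem isCrossingClosedOrbit_of_ret {S : LienardPWL} {y₀ y₁ τ σ : ℝ} (hy : 0 < y₀) (hy' : y₁ < 0)
    (hL : Ret S.TL S.DL S.aL y₀ y₁ τ) (hR : Ret (-S.TR) S.DR (-S.aR) y₀ y₁ σ) {U : Set (ℝ × ℝ)}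
    (hLU : ∀ u ∈ Icc 0 τ, (flowX S.TL S.DL S.aL y₀ u, flowY S.TL S.DL S.aL y₀ u) ∈ U)
    (hRU : ∀ u ∈ Icc 0 σ, (-flowX (-S.TR) S.DR (-S.aR) y₀ u,
        flowY (-S.TR) S.DR (-S.aR) y₀ u) ∈ U) :
    ∃ Γ, S.IsCrossingClosedOrbit Γ ∧ Γ ⊆ U ∧ ((0 : ℝ), y₀) ∈ Γ := by
  have hτ := hL.pos
  have hσ := hR.pos
  have hP : 0 < σ + τ := by linarith
  set xl := flowX S.TL S.DL S.aL y₀ with hxl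
  set yl := flowY S.TL S.DL S.aL y₀ with hyl
  set xr : ℝ → ℝ := fun t => -flowX (-S.TR) S.DR (-S.aR) y₀ (-t) with hxr
  set yr : ℝ → ℝ := fun t => flowY (-S.TR) S.DR (-S.aR) y₀ (-t) with hyr
  have ol : IsLinearOrbit S.TL S.DL S.aL xl yl := isLinearOrbit_flow _ _ _ _
  have or : IsLinearOrbit S.TR S.DR S.aR xr yr := by
    have := (isLinearOrbit_flow (-S.TR) S.DR (-S.aR) y₀).reflect
    rwa [neg_neg, neg_neg] at this
  have xl0 : xl 0 = 0 := flowX_zero _ _ _ _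
  have yl0 : yl 0 = y₀ := flowY_zero _ _ _ _
  have xr0 : xr 0 = 0 := by simp [hxr, flowX_zero]
  have yr0 : yr 0 = y₀ := by simp [hyr, flowY_zero]
  have xlτ : xl τ = 0 := hL.zero
  have ylτ : yl τ = y₁ := hL.val
  have xrσ : xr (-σ) = 0 := by simp [hxr, hR.zero]
  have yrσ : yr (-σ) = y₁ := by simp [hyr, hR.val]
  have xlneg : ∀ t ∈ Ioo 0 τ, xl t < 0 := hL.neg
  have xrpos : ∀ t ∈ Ioo (-σ) 0, 0 < xr t := fun t ht => by
    have := hR.neg (-t) ⟨by linarith [ht.2], by linarith [ht.1]⟩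
    simpa [hxr] using this
  set X := periodicGlue hP xr xl with hX
  set Y := periodicGlue hP yr yl with hY
  have pX : Function.Periodic X (σ + τ) := periodicGlue_periodic _ _ _
  have pY : Function.Periodic Y (σ + τ) := periodicGlue_periodic _ _ _
  have XR : ∀ t ∈ Icc (-σ) 0, X t = xr t := fun t ht =>
    periodicGlue_right hP hτ (by rw [xl0, xr0]) ht
  have YR : ∀ t ∈ Icc (-σ) 0, Y t = yr t := fun t ht =>
    periodicGlue_right hP hτ (by rw [yl0, yr0]) ht
  have XL : ∀ t ∈ Icc 0 τ, X t = xl t := fun t ht =>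
    periodicGlue_left hP hσ (by rw [xlτ, xrσ]) ht
  have YL : ∀ t ∈ Icc 0 τ, Y t = yl t := fun t ht =>
    periodicGlue_left hP hσ (by rw [ylτ, yrσ]) ht
  have XS : ∀ t ∈ Icc (-σ - τ) (-σ), X t = xl (t + (σ + τ)) := fun t ht =>
    periodicGlue_left_shift hP hσ (by rw [xlτ, xrσ]) ht
  have YS : ∀ t ∈ Icc (-σ - τ) (-σ), Y t = yl (t + (σ + τ)) := fun t ht =>
    periodicGlue_left_shift hP hσ (by rw [ylτ, yrσ]) ht
  have hend : -σ + (σ + τ) = τ := by ring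
  -- By periodicity one period suffices. At the seam `-σ` the left neighbourhood is the end of the
  -- left arc, shifted by a period.
  have hloc : ∀ u ∈ Ico (-σ) τ, ContinuousAt Y u ∧
      (X u < 0 → HasDerivAt X (S.TL * X u - Y u) u ∧ HasDerivAt Y (S.DL * X u - S.aL) u) ∧
      (0 < X u → HasDerivAt X (S.TR * X u - Y u) u ∧ HasDerivAt Y (S.DR * X u - S.aR) u) ∧
      (X u = 0 → Y u ≠ 0 ∧ HasDerivAt X (-(Y u)) u) := by
    intro u hu
    rcases hu.1.eq_or_lt with rfl | h1
    · have eX : X (-σ) = 0 := by rw [XR _ ⟨le_rfl, by linarith⟩, xrσ]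
      have eY : Y (-σ) = y₁ := by rw [YR _ ⟨le_rfl, by linarith⟩, yrσ]
      refine ⟨?_, fun h => absurd eX h.ne, fun h => absurd eX h.ne', fun _ => ?_⟩
      · refine continuousAt_of_sides (a := -σ - τ) (b := 0) (by linarith) (by linarith) YS YR ?_
          (or (-σ)).2.continuousAt
        refine ContinuousAt.comp (g := yl) ?_ (by fun_prop)
        exact (ol _).2.continuousAt
      · rw [eY]
        refine ⟨hy'.ne, ?_⟩
        refine hasDerivAt_of_sides (a := -σ - τ) (b := 0) (by linarith) (by linarith) XS XR ?_ ?_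
        · refine HasDerivAt.comp_add_const (f := xl) (-σ) (σ + τ) ?_
          rw [hend]
          exact (ol τ).1.congr_deriv (by rw [xlτ, ylτ]; ring)
        · exact (or (-σ)).1.congr_deriv (by rw [xrσ, yrσ]; ring)
    rcases lt_trichotomy u 0 with h2 | rfl | h2
    · have eX := XR u ⟨h1.le, h2.le⟩
      have eY := YR u ⟨h1.le, h2.le⟩
      have a1 : ∀ s ∈ Icc (-σ) u, s ∈ Icc (-σ) 0 := fun s hs => ⟨hs.1, hs.2.trans h2.le⟩
      have a2 : ∀ s ∈ Icc u 0, s ∈ Icc (-σ) 0 := fun s hs => ⟨h1.le.trans hs.1, hs.2⟩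
      have hpos := xrpos u ⟨h1, h2⟩
      have dX : HasDerivAt X (S.TR * X u - Y u) u := by
        rw [eX, eY]
        exact hasDerivAt_of_sides h1 h2 (fun s hs => XR s (a1 s hs)) (fun s hs => XR s (a2 s hs))
          (or u).1 (or u).1
      have dY : HasDerivAt Y (S.DR * X u - S.aR) u := by
        rw [eX]
        exact hasDerivAt_of_sides h1 h2 (fun s hs => YR s (a1 s hs)) (fun s hs => YR s (a2 s hs))
          (or u).2 (or u).2
      exact ⟨dY.continuousAt, fun h => by linarith, fun _ => ⟨dX, dY⟩, fun h => by linarith⟩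
    · have eX : X 0 = 0 := by rw [XL _ ⟨le_rfl, hτ.le⟩, xl0]
      have eY : Y 0 = y₀ := by rw [YL _ ⟨le_rfl, hτ.le⟩, yl0]
      refine ⟨?_, fun h => absurd eX h.ne, fun h => absurd eX h.ne', fun _ => ?_⟩
      · exact continuousAt_of_sides h1 hτ YR YL (or 0).2.continuousAt (ol 0).2.continuousAt
      · rw [eY]
        refine ⟨hy.ne', hasDerivAt_of_sides h1 hτ XR XL ?_ ?_⟩
        · exact (or 0).1.congr_deriv (by rw [xr0, yr0]; ring)
        · exact (ol 0).1.congr_deriv (by rw [xl0, yl0]; ring)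
    · have eX := XL u ⟨h2.le, hu.2.le⟩
      have eY := YL u ⟨h2.le, hu.2.le⟩
      have a1 : ∀ s ∈ Icc 0 u, s ∈ Icc 0 τ := fun s hs => ⟨hs.1, hs.2.trans hu.2.le⟩
      have a2 : ∀ s ∈ Icc u τ, s ∈ Icc 0 τ := fun s hs => ⟨h2.le.trans hs.1, hs.2⟩
      have hneg := xlneg u ⟨h2, hu.2⟩
      have dX : HasDerivAt X (S.TL * X u - Y u) u := by
        rw [eX, eY]
        exact hasDerivAt_of_sides h2 hu.2 (fun s hs => XL s (a1 s hs))
          (fun s hs => XL s (a2 s hs)) (ol u).1 (ol u).1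
      have dY : HasDerivAt Y (S.DL * X u - S.aL) u := by
        rw [eX]
        exact hasDerivAt_of_sides h2 hu.2 (fun s hs => YL s (a1 s hs))
          (fun s hs => YL s (a2 s hs)) (ol u).2 (ol u).2
      exact ⟨dY.continuousAt, fun _ => ⟨dX, dY⟩, fun h => by linarith, fun h => by linarith⟩
  have hmod : ∀ t, ∃ n : ℤ, t - n • (σ + τ) ∈ Ico (-σ) τ := fun t => by
    refine ⟨toIcoDiv hP (-σ) t, ?_⟩
    have := toIcoMod_mem_Ico hP (-σ) t
    rwa [hend, ← self_sub_toIcoDiv_zsmul] at this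
  refine ⟨range fun t => (X t, Y t), ⟨X, Y, ⟨?_, ?_, ?_, ?_⟩, ⟨σ + τ, hP, pX, pY⟩,
    ⟨0, by rw [XL _ ⟨le_rfl, hτ.le⟩, xl0]⟩, rfl⟩, ?_, ⟨0, ?_⟩⟩
  · refine continuous_iff_continuousAt.2 fun t => ?_
    obtain ⟨n, hn⟩ := hmod t
    exact pY.continuousAt n (hloc _ hn).1
  · intro t ht
    obtain ⟨n, hn⟩ := hmod t
    have h := (hloc _ hn).2.1
    rw [pX.sub_zsmul_eq, pY.sub_zsmul_eq] at h
    exact ⟨pX.hasDerivAt n (h ht).1, pY.hasDerivAt n (h ht).2⟩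
  · intro t ht
    obtain ⟨n, hn⟩ := hmod t
    have h := (hloc _ hn).2.2.1
    rw [pX.sub_zsmul_eq, pY.sub_zsmul_eq] at h
    exact ⟨pX.hasDerivAt n (h ht).1, pY.hasDerivAt n (h ht).2⟩
  · intro t ht
    obtain ⟨n, hn⟩ := hmod t
    have h := (hloc _ hn).2.2.2
    rw [pX.sub_zsmul_eq, pY.sub_zsmul_eq] at h
    exact ⟨(h ht).1, pX.hasDerivAt n (h ht).2⟩
  · rintro _ ⟨t, rfl⟩
    obtain ⟨n, hn⟩ := hmod t
    simp only
    rw [← pX.sub_zsmul_eq n, ← pY.sub_zsmul_eq n (x := t)]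
    rcases le_total 0 (t - n • (σ + τ)) with h0 | h0
    · rw [XL _ ⟨h0, hn.2.le⟩, YL _ ⟨h0, hn.2.le⟩]
      exact hLU _ ⟨h0, hn.2.le⟩
    · rw [XR _ ⟨hn.1, h0⟩, YR _ ⟨hn.1, h0⟩]
      exact hRU _ ⟨by linarith, by linarith [hn.1]⟩
  · simp only [XL 0 ⟨le_rfl, hτ.le⟩, YL 0 ⟨le_rfl, hτ.le⟩, xl0, yl0]

end LienardPWL

/-! ### Vanishing divergence integral and conclusion. -/

/-- The arcs of orbits stay in an open set under small changes of the initial point. -/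
theorem eventually_arc_mem {Φ : ℝ × ℝ → ℝ × ℝ} (hΦ : Continuous Φ) {U : Set (ℝ × ℝ)}
    (hU : IsOpen U) {y₀ τ : ℝ} {θ : ℝ → ℝ} (hτ : 0 < τ) (hθ : ContinuousAt θ y₀) (hθ0 : θ y₀ = τ)
    (h : ∀ t ∈ Icc 0 τ, Φ (y₀, t) ∈ U) : ∀ᶠ y in 𝓝 y₀, ∀ t ∈ Icc 0 (θ y), Φ (y, t) ∈ U := by
  have hev : ∀ t ∈ Icc 0 τ, ∀ᶠ q in 𝓝 (y₀, t), Φ q ∈ U := fun t ht =>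
    hΦ.continuousAt.eventually (hU.mem_nhds (h t ht))
  have e1 : ∀ᶠ y in 𝓝 y₀, ∀ t ∈ Icc 0 τ, Φ (y, t) ∈ U :=
    isCompact_Icc.eventually_forall_of_forall_eventually hev
  obtain ⟨ε, hε, e2⟩ := exists_radius_of_eventually_prod (hev τ ⟨hτ.le, le_rfl⟩)
  have e3 : ∀ᶠ y in 𝓝 y₀, θ y < τ + ε := hθ.eventually (gt_mem_nhds (by linarith))
  filter_upwards [e1, e2, e3] with y k1 k2 k3 t ht
  rcases le_or_gt t τ with hle | hgt
  · exact k1 t ⟨ht.1, hle⟩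
  · exact k2 t (by rw [abs_lt]; constructor <;> linarith [ht.2])

namespace LienardPWL

theorem halfMap_eq {R : ℝ → ℝ → Prop} {y₀ y₁ : ℝ} (h : R y₀ y₁) (hu : ∀ v, R y₀ v → v = y₁) :
    halfMap R y₀ = y₁ := by
  have hex : ∃ y₁, R y₀ y₁ := ⟨y₁, h⟩
  rw [halfMap, dif_pos hex]
  exact hu _ hex.choose_spec

theorem yL_eq {S : LienardPWL} {y₀ y₁ τ : ℝ} (h : Ret S.TL S.DL S.aL y₀ y₁ τ) :
    S.yL y₀ = y₁ := by
  refine halfMap_eq ((S.leftReturn_iff _ _).2 ⟨τ, h⟩) fun v hv => ?_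
  obtain ⟨σ, hv⟩ := (S.leftReturn_iff _ _).1 hv
  exact hv.unique h

theorem yR_eq {S : LienardPWL} {y₀ y₁ τ : ℝ} (h : Ret (-S.TR) S.DR (-S.aR) y₀ y₁ τ) :
    S.yR y₀ = y₁ := by
  refine halfMap_eq ((S.rightReturn_iff _ _).2 ⟨τ, h⟩) fun v hv => ?_
  obtain ⟨σ, hv⟩ := (S.rightReturn_iff _ _).1 hv
  exact hv.unique h

/-- If the divergence integral along two arcs with common endpoints vanishes, then the two
half-maps agree near the starting point. -/
theorem eventually_halfMaps_eq {T D a T' D' a' y₀ y₁ τ σ : ℝ} {θ θ' g g' : ℝ → ℝ}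
    (h : Ret T D a y₀ y₁ τ) (h' : Ret T' D' a' y₀ y₁ σ) (hy : 0 < y₀) (hy' : y₁ < 0)
    (he : T * τ = T' * σ) (hθ : ∀ᶠ y in 𝓝 y₀, Ret T D a y (g y) (θ y))
    (hθ' : ∀ᶠ y in 𝓝 y₀, Ret T' D' a' y (g' y) (θ' y)) (hg : ∀ᶠ y in 𝓝 y₀, g y < 0)
    (hg' : ∀ᶠ y in 𝓝 y₀, g' y < 0) : ∀ᶠ y in 𝓝 y₀, g y = g' y := by
  rcases eq_or_ne T 0 with rfl | hT
  · have hT' : T' = 0 := by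
      rw [zero_mul] at he
      exact (mul_eq_zero.1 he.symm).resolve_right h'.pos.ne'
    subst hT'
    filter_upwards [hθ, hθ', hg, hg', lt_mem_nhds hy] with y k k' n n' hpos
    rw [k.eq_neg_of_trace_zero hpos n, k'.eq_neg_of_trace_zero hpos n']
  · obtain ⟨hD, ha⟩ := h.parameters_eq h' hy hy' hT he
    have hτ := h.pos
    have hσ := h'.pos
    -- Rescaling time by `τ / σ` carries the first system to the second without changing ordinates
    -- on the switching line.
    have e1 : τ / σ * T = T' := by field_simp; linarith
    have e2 : (τ / σ) ^ 2 * D = D' := by field_simp; linarith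
    have e3 : τ / σ * a = a' := by field_simp; linarith
    filter_upwards [hθ, hθ'] with y k k'
    have := k.scale (div_pos hτ hσ)
    rw [e1, e2, e3] at this
    exact this.unique k'

theorem not_isDegenerateLimitCycle (S : LienardPWL) (Γ : Set (ℝ × ℝ)) :
    ¬ S.IsDegenerateLimitCycle Γ := by
  rintro ⟨⟨hΓ, U, hU, hΓU, hiso⟩, hnot⟩
  obtain ⟨y₀, y₁, τ, σ, hy, hy', hL, hR, hLΓ, hRΓ, htop⟩ := hΓ.exists_arcs
  obtain ⟨θ, hθ0, hθ, hretL, hdL⟩ := hL.exists_local hy hy'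
  obtain ⟨θ', hθ0', hθ', hretR, hdR⟩ := hR.exists_local hy hy'
  set g : ℝ → ℝ := fun y => flowY S.TL S.DL S.aL y (θ y) with hg
  set g' : ℝ → ℝ := fun y => flowY (-S.TR) S.DR (-S.aR) y (θ' y) with hg'
  have hg0 : g y₀ = y₁ := by simp only [hg, hθ0, hL.val]
  have hg0' : g' y₀ = y₁ := by simp only [hg', hθ0', hR.val]
  have hpos : ∀ᶠ y in 𝓝 y₀, 0 < y := lt_mem_nhds hy
  have hdom : S.displacementDomain ∈ 𝓝 y₀ := by
    filter_upwards [hretL, hretR, hpos] with y kL kR kp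
    exact ⟨⟨kp.le, Or.inl ⟨_, (S.leftReturn_iff _ _).2 ⟨_, kL⟩⟩⟩,
      ⟨kp.le, Or.inl ⟨_, (S.rightReturn_iff _ _).2 ⟨_, kR⟩⟩⟩⟩
  have hdisp : S.displacement =ᶠ[𝓝 y₀] fun y => g' y - g y := by
    filter_upwards [hretL, hretR] with y kL kR
    rw [displacement, yL_eq kL, yR_eq kR]
  have hder := (hdR.sub hdL).congr_of_eventuallyEq hdisp
  have hzero : S.displacement y₀ = 0 := by
    rw [hdisp.self_of_nhds]
    simp only [hg0, hg0', sub_self]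
  have hmem : ((0 : ℝ), y₀) ∈ Γ := by
    have := hLΓ 0 ⟨le_rfl, hL.pos.le⟩
    rwa [flowX_zero, flowY_zero] at this
  -- Otherwise the two slopes, which share the factor `y₀ / y₁`, differ and the orbit is hyperbolic.
  have hdiv : S.TL * τ = -S.TR * σ := by
    by_contra hne
    refine hnot ⟨y₀, hy, hmem, mem_interior_iff_mem_nhds.2 hdom, hzero, _, ?_, hder⟩
    rw [← mul_sub]
    refine mul_ne_zero (div_ne_zero hy.ne' hy'.ne) (sub_ne_zero.2 fun h => hne ?_)
    exact (Real.exp_injective h).symm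
  have hneg : ∀ᶠ y in 𝓝 y₀, g y < 0 :=
    hdL.continuousAt.eventually (gt_mem_nhds (by rw [hg0]; exact hy'))
  have hneg' : ∀ᶠ y in 𝓝 y₀, g' y < 0 :=
    hdR.continuousAt.eventually (gt_mem_nhds (by rw [hg0']; exact hy'))
  have heq := eventually_halfMaps_eq hL hR hy hy' hdiv hretL hretR hneg hneg'
  have hUL := eventually_arc_mem ((continuous_flowX_prod S.TL S.DL S.aL).prodMk
    (continuous_flowY_prod S.TL S.DL S.aL)) hU hL.pos hθ hθ0 fun t ht => hΓU (hLΓ t ht)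
  have hUR := eventually_arc_mem ((continuous_flowX_prod (-S.TR) S.DR (-S.aR)).neg.prodMk
    (continuous_flowY_prod (-S.TR) S.DR (-S.aR))) hU hR.pos hθ' hθ0' fun t ht => hΓU (hRΓ t ht)
  have hall := hretL.and (hretR.and (heq.and (hpos.and (hneg.and (hUL.and hUR)))))
  -- A start strictly above the highest crossing of `Γ` gives a closed orbit in `U` that cannot be
  -- `Γ`.
  obtain ⟨v, ⟨kL, kR, ke, kp, kn, kUL, kUR⟩, hv⟩ :=
    ((hall.filter_mono nhdsWithin_le_nhds).and (self_mem_nhdsWithin : Ioi y₀ ∈ 𝓝[>] y₀)).exists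
  rw [← ke] at kR
  obtain ⟨Γ', hΓ', hsub, hmem'⟩ := isCrossingClosedOrbit_of_ret kp kn kL kR kUL kUR
  rw [hiso Γ' hΓ' hsub] at hmem'
  exact htop v hv hmem'

end LienardPWL

theorem mainTheorem3 (S : LienardPWL) :
    ¬ ∃ Γ : Set (ℝ × ℝ), S.IsDegenerateLimitCycle Γ := by
  rintro ⟨Γ, hΓ⟩
  exact S.not_isDegenerateLimitCycle Γ hΓ
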